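/- Let $M$ be a smooth (Hausdorff, finite-dimensional) manifold with a Poisson structure $\Pi$, i.e. a smooth bivector field such that $\{f,g\}=\Pi(df,dg)$ satisfies the Jacobi identity. Regard $T^*M$ as a Lie algebroid with anchor $\alpha\mapsto\Pi(\alpha,\cdot)$ and bracket determined by $[df,dg]=d\{f,g\}$, and let $d_\Pi$ be its Chevalley–Eilenberg differential. Let $|\Delta^n|$ be the standard geometric $n$-simplex. Let $\Pi_\infty(T^*M)$ be the simplicial set whose $n$-simplices are the smooth Lie algebroid morphisms $X:T|\Delta^n|\to T^*M$ which vanish at the vertices of $|\Delta^n|$ (simplicial operators act by restriction along the corresponding affine maps), with face maps $d_i$. For a vector bundle morphism $X:T|\Delta^n|\to T^*M$ let $X^*\Pi$ be the $2$-form $(v,w)\mapsto\Pi(X(v),X(w))$ on $|\Delta^n|$. Let $\hbar\in\mathbb R\setminus\{0\}$. Then: 1. $d_\Pi\Pi=0$, and for every $n$ and every Lie algebroid morphism $X:T|\Delta^n|\to T^*M$ the form $X^*\Pi$ is smooth and closed. 2. The integral $S[X]=\int_{|\Delta^2|}X^*\Pi$ exists for every Lie algebroid morphism $X:T|\Delta^2|\to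 T^*M$, and $S$ is an $\mathbb R$-valued $2$-cocycle on $\Pi_\infty(T^*M)$: for every $3$-simplex $Y$ of $\Pi_\infty(T^*M)$, $(\delta^*S)(Y)=\sum_{i=0}^{3}(-1)^i S[d_iY]=0$. 3. $c(X)=e^{\frac{i}{\hbar}S[X]}$ is an $S^1$-valued $2$-cocycle on $\Pi_\infty(T^*M)$. Both $S$ and $c$ take equal values on two $2$-simplices that are homotopic relative to their boundary through a $3$-simplex (same faces, and both are faces of a $3$-simplex whose other two faces are degenerate), so they descend to the composable pairs $\Pi^{(2)}_\infty/\Pi^{(3)}_\infty$ of $\Pi_2(T^*M)$. 4. The cocycle $c$ determines a multiplicative line bundle on $\Pi_\infty(T^*M)$: over the arrows ($1$-simplices) it is the trivial complex line bundle; over a $2$-simplex $X$ the multiplication of the fibre over $d_2X$ with the fibre over $d_0X$ into the fibre over $d_1X$ is $(\lambda,\beta)\mapsto\lambda\beta\,c(X)$; this is bilinear and nonzero, and it is associative over every $3$-simplex. Moreover there is a simplicial set $\mathcal L$ with a simplicial map to $\Pi_\infty(T^*M)$, with $n$-simplices $\Pi^{(n)}_\infty(T^*M)\times\mathbb C^n$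 lying over $\Pi_\infty^{(n)}(T^*M)$ by the projection, whose face maps are $$d_0(X,\lambda_1,\dots,\lambda_n)=(d_0X,\lambda_2,\dots,\lambda_n),\qquad d_n(X,\lambda_1,\dots,\lambda_n)=(d_nX,\lambda_1,\dots,\lambda_{n-1}),$$ $$d_i(X,\lambda_1,\dots,\lambda_n)=\bigl(d_iX,\lambda_1,\dots,\lambda_{i-1},\ \lambda_i\lambda_{i+1}\,c(X_{i-1,i,i+1}),\ \lambda_{i+2},\dots,\lambda_n\bigr)\quad(0<i<n),$$ where $X_{i-1,i,i+1}$ is the $2$-dimensional face of $X$ with vertices $i-1,i,i+1$. -/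

import Mathlib

open scoped Manifold ContDiff Simplicial Bundle

universe u

noncomputable section

namespace PoissonCocycle

/-! ### The geometric standard simplices -/

/-- The standard `n`-simplex `|Δⁿ|`, in the affine coordinates `(t₁, …, tₙ)` obtained from the
barycentric coordinates `(t₀, …, tₙ)` by dropping `t₀ = 1 - t₁ - ⋯ - tₙ`. -/
def simplex (n : ℕ) : Set (Fin n → ℝ) :=
  {t | (∀ i, 0 ≤ t i) ∧ ∑ i, t i ≤ 1}

/-- The `j`-th vertex of `|Δⁿ|`: the origin for `j = 0`, the basis vector `e_j` otherwise. -/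
def vertex (n : ℕ) (j : Fin (n + 1)) : Fin n → ℝ :=
  fun k => if j = k.succ then 1 else 0

/-- The linear part of the affine map `|Δᵐ| → |Δⁿ|` which sends vertex `i` to vertex `θ i`. -/
def simplexLin {m n : ℕ} (θ : Fin (m + 1) → Fin (n + 1)) : (Fin m → ℝ) →L[ℝ] (Fin n → ℝ) :=
  ∑ i : Fin m, (ContinuousLinearMap.proj (R := ℝ) (φ := fun _ : Fin m => ℝ) i).smulRight
    (vertex n (θ i.succ) - vertex n (θ 0))

/-- The affine map which sends vertex `i` of `|Δᵐ|` to vertex `θ i` of `|Δⁿ|`. -/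
def simplexMap {m n : ℕ} (θ : Fin (m + 1) → Fin (n + 1)) (t : Fin m → ℝ) : Fin n → ℝ :=
  vertex n (θ 0) + simplexLin θ t

theorem vertex_mem (n : ℕ) (j : Fin (n + 1)) : vertex n j ∈ simplex n := by
  refine ⟨fun i => ?_, ?_⟩
  · unfold vertex; split_ifs <;> norm_num
  · induction j using Fin.cases with
    | zero =>
      have : ∀ k : Fin n, (0 : Fin (n + 1)) ≠ k.succ := fun k => (Fin.succ_ne_zero k).symm
      simp [vertex, this]
    | succ j => simp [vertex]

theorem simplexLin_apply {m n : ℕ} (θ : Fin (m + 1) → Fin (n + 1)) (v : Fin m → ℝ) :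
    simplexLin θ v = ∑ i : Fin m, v i • (vertex n (θ i.succ) - vertex n (θ 0)) := by
  simp [simplexLin]

theorem simplexLin_vertex {m n : ℕ} (θ : Fin (m + 1) → Fin (n + 1)) (j : Fin (m + 1)) :
    simplexLin θ (vertex m j) = vertex n (θ j) - vertex n (θ 0) := by
  rw [simplexLin_apply]
  induction j using Fin.cases with
  | zero =>
    have : ∀ k : Fin m, (0 : Fin (m + 1)) ≠ k.succ := fun k => (Fin.succ_ne_zero k).symm
    simp [vertex, this]
  | succ j => simp [vertex]

theorem simplexMap_vertex {m n : ℕ} (θ : Fin (m + 1) → Fin (n + 1)) (j : Fin (m + 1)) :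
    simplexMap θ (vertex m j) = vertex n (θ j) := by
  simp [simplexMap, simplexLin_vertex]

theorem simplexLin_id (n : ℕ) (v : Fin n → ℝ) : simplexLin (fun i : Fin (n + 1) => i) v = v := by
  rw [simplexLin_apply]
  have : ∀ k : Fin n, (0 : Fin (n + 1)) ≠ k.succ := fun k => (Fin.succ_ne_zero k).symm
  ext k
  simp [vertex, this]

theorem simplexMap_id (n : ℕ) (t : Fin n → ℝ) : simplexMap (fun i : Fin (n + 1) => i) t = t := by
  have : ∀ k : Fin n, (0 : Fin (n + 1)) ≠ k.succ := fun k => (Fin.succ_ne_zero k).symm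
  rw [simplexMap, simplexLin_id]
  ext k
  simp [vertex, this]

theorem simplexLin_comp {l m n : ℕ} (φ : Fin (l + 1) → Fin (m + 1)) (θ : Fin (m + 1) → Fin (n + 1))
    (v : Fin l → ℝ) : simplexLin (fun i => θ (φ i)) v = simplexLin θ (simplexLin φ v) := by
  rw [simplexLin_apply, simplexLin_apply φ, map_sum]
  simp [simplexLin_vertex]

theorem simplexMap_comp {l m n : ℕ} (φ : Fin (l + 1) → Fin (m + 1)) (θ : Fin (m + 1) → Fin (n + 1))
    (t : Fin l → ℝ) : simplexMap (fun i => θ (φ i)) t = simplexMap θ (simplexMap φ t) := by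
  simp [simplexMap, simplexLin_comp, simplexLin_vertex, ← add_assoc]

theorem convex_simplex (n : ℕ) : Convex ℝ (simplex n) := by
  intro x hx y hy a b ha hb hab
  refine ⟨fun i => ?_, ?_⟩
  · have := hx.1 i; have := hy.1 i
    simp only [Pi.add_apply, Pi.smul_apply, smul_eq_mul]; positivity
  · simp only [Pi.add_apply, Pi.smul_apply, smul_eq_mul, Finset.sum_add_distrib, ← Finset.mul_sum]
    have h1 := mul_le_mul_of_nonneg_left hx.2 ha
    have h2 := mul_le_mul_of_nonneg_left hy.2 hb
    linarith

theorem simplexMap_mem {m n : ℕ} (θ : Fin (m + 1) → Fin (n + 1)) {t : Fin m → ℝ}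
    (ht : t ∈ simplex m) : simplexMap θ t ∈ simplex n := by
  have key : simplexMap θ t = ∑ i : Fin (m + 1),
      (Fin.cons (1 - ∑ k, t k) t : Fin (m + 1) → ℝ) i • vertex n (θ i) := by
    rw [Fin.sum_univ_succ, simplexMap, simplexLin_apply]
    simp only [Fin.cons_zero, Fin.cons_succ, smul_sub, Finset.sum_sub_distrib, sub_smul, one_smul,
      Finset.sum_smul]
    abel
  rw [key]
  refine (convex_simplex n).sum_mem (fun i _ => ?_) ?_ (fun i _ => vertex_mem n _)
  · induction i using Fin.cases with
    | zero => simpa using ht.2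
    | succ i => simpa using ht.1 i
  · rw [Fin.sum_univ_succ]; simp

theorem interior_simplex_nonempty (n : ℕ) : (interior (simplex n)).Nonempty := by
  refine ⟨fun _ => 1 / (n + 1 : ℝ), ?_⟩
  rw [mem_interior]
  refine ⟨(⋂ i : Fin n, (fun t : Fin n → ℝ => t i) ⁻¹' Set.Ioi 0) ∩
    (fun t : Fin n → ℝ => ∑ i, t i) ⁻¹' Set.Iio 1, fun t ht => ?_, ?_, ?_⟩
  · rw [Set.mem_inter_iff, Set.mem_iInter] at ht
    exact ⟨fun i => le_of_lt (ht.1 i), le_of_lt ht.2⟩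
  · refine IsOpen.inter (isOpen_iInter_of_finite fun i => ?_) ?_
    · exact isOpen_Ioi.preimage (continuous_apply i)
    · exact isOpen_Iio.preimage (by fun_prop)
  · rw [Set.mem_inter_iff, Set.mem_iInter]
    refine ⟨fun i => ?_, ?_⟩
    · simp only [Set.mem_preimage, Set.mem_Ioi]; positivity
    · have : (n : ℝ) < n + 1 := by linarith
      simp only [Set.mem_preimage, Set.mem_Iio, Finset.sum_const, Finset.card_univ,
        Fintype.card_fin, nsmul_eq_mul]
      rw [mul_one_div, div_lt_one (by positivity)]
      exact this

theorem uniqueDiffOn_simplex (n : ℕ) : UniqueDiffOn ℝ (simplex n) :=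
  uniqueDiffOn_convex (convex_simplex n) (interior_simplex_nonempty n)

/-- The identity on `|Δⁿ|`; points outside of `|Δⁿ|` are sent to vertex `0`. It serves to regard
functions on the subtype `|Δⁿ|` as functions on `ℝⁿ` whose values outside of `|Δⁿ|` are
irrelevant. -/
def toSimplex (n : ℕ) (t : Fin n → ℝ) : simplex n :=
  open Classical in if h : t ∈ simplex n then ⟨t, h⟩ else ⟨vertex n 0, vertex_mem n 0⟩

theorem toSimplex_of_mem {n : ℕ} {t : Fin n → ℝ} (h : t ∈ simplex n) : toSimplex n t = ⟨t, h⟩ := by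
  simp [toSimplex, h]

/-- The map of simplices induced by a map of vertices. -/
def simplexSubMap {m n : ℕ} (θ : Fin (m + 1) → Fin (n + 1)) (t : simplex m) : simplex n :=
  ⟨simplexMap θ t, simplexMap_mem θ t.2⟩

/-! ### Poisson manifolds -/

section Poisson

variable {d : ℕ} {M : Type*} [TopologicalSpace M] [ChartedSpace (EuclideanSpace ℝ (Fin d)) M]

/-- The cotangent space `T*_p M`. -/
abbrev Cotangent (p : M) : Type :=
  TangentSpace (𝓡 d) p →L[ℝ] Bundle.Trivial M ℝ p

/-- The differential `d_p f ∈ T*_p M`. -/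
def differential (f : M → ℝ) (p : M) : Cotangent (d := d) p :=
  mvfderiv (𝓡 d) f p

/-- Evaluation of covectors at a tangent vector, i.e. a tangent vector as a `1`-vector
(a linear form on `T*_p M`). -/
def evalVector {p : M} (v : TangentSpace (𝓡 d) p) : Cotangent (d := d) p [⋀^Fin 1]→L[ℝ] ℝ :=
  ContinuousAlternatingMap.ofSubsingleton ℝ (Cotangent (d := d) p) ℝ (0 : Fin 1)
    { toFun := fun α => α v
      map_add' := fun _ _ => rfl
      map_smul' := fun _ _ => rfl
      cont := continuous_eval_const v }

variable (d M) in
/-- A `k`-vector field on `M` (no regularity imposed): an alternating `k`-linear form on each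
`T*_p M`. These are the degree `k` forms on the vector bundle `T*M`. -/
abbrev MultiVector (k : ℕ) : Type _ := ∀ p : M, Cotangent (d := d) p [⋀^Fin k]→L[ℝ] ℝ

variable (d M) in
/-- A Poisson structure on `M`: a smooth bivector field `Π` such that `{f, g} = Π(df, dg)`
satisfies the Jacobi identity. -/
structure PoissonStructure where
  bivector : MultiVector d M 2
  smooth' : ∀ f g : M → ℝ, ContMDiff (𝓡 d) 𝓘(ℝ, ℝ) ∞ f → ContMDiff (𝓡 d) 𝓘(ℝ, ℝ) ∞ g →
    ContMDiff (𝓡 d) 𝓘(ℝ, ℝ) ∞ fun p => bivector p ![differential f p, differential g p]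
  jacobi' : ∀ f g h : M → ℝ, ContMDiff (𝓡 d) 𝓘(ℝ, ℝ) ∞ f → ContMDiff (𝓡 d) 𝓘(ℝ, ℝ) ∞ g →
    ContMDiff (𝓡 d) 𝓘(ℝ, ℝ) ∞ h → ∀ p,
    bivector p ![differential f p,
        differential (fun q => bivector q ![differential g q, differential h q]) p] +
      bivector p ![differential g p,
        differential (fun q => bivector q ![differential h q, differential f q]) p] +
      bivector p ![differential h p,
        differential (fun q => bivector q ![differential f q, differential g q]) p] = 0

namespace PoissonStructure

variable (P : PoissonStructure d M)

/-- The Poisson bracket `{f, g} = Π(df, dg)`. -/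
def bracket (f g : M → ℝ) (p : M) : ℝ :=
  P.bivector p ![differential f p, differential g p]

/-! The Chevalley–Eilenberg differential `d_Π` of the Lie algebroid `T*M`, whose anchor is
`α ↦ Π(α, ·)` and whose bracket is determined by `[df, dg] = d{f, g}`. To evaluate the
differential of a form at covectors, extend these to local sections; here they are extended to
exact `1`-forms `df, dg, dh`. -/

/-- `(d_Π f)(α) = Π(α, df)`, for a function `f` (degree `0`). -/
def dFunction (f : M → ℝ) (p : M) (α : Cotangent (d := d) p) : ℝ :=
  P.bivector p ![α, differential f p]

/-- `(d_Π V)(df, dg) = {f, V g} - {g, V f} - V {f, g}`, for a vector field `V`, that is a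
section of the dual of `T*M` (degree `1`). -/
def dVector (V : ∀ p : M, TangentSpace (𝓡 d) p) (f g : M → ℝ) (p : M) : ℝ :=
  P.bracket f (fun q => differential g q (V q)) p
    - P.bracket g (fun q => differential f q (V q)) p
    - differential (P.bracket f g) p (V p)

/-- `(d_Π W)(df, dg, dh)`, for a bivector field `W` (degree `2`). -/
def dBivector (W : MultiVector d M 2) (f g h : M → ℝ) (p : M) : ℝ :=
  P.bracket f (fun q => W q ![differential g q, differential h q]) p
    - P.bracket g (fun q => W q ![differential f q, differential h q]) p
    + P.bracket h (fun q => W q ![differential f q, differential g q]) p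
    - W p ![differential (P.bracket f g) p, differential h p]
    + W p ![differential (P.bracket f h) p, differential g p]
    - W p ![differential (P.bracket g h) p, differential f p]

end PoissonStructure

/-! ### Morphisms from the tangent bundle of a simplex to the cotangent bundle -/

variable [IsManifold (𝓡 d) ∞ M]

variable (d M) in
/-- A smooth vector bundle morphism `T|Δⁿ| → T*M`: a map `base : |Δⁿ| → M` and, for every point
`t`, a linear map from `T_t|Δⁿ| = ℝⁿ` to the cotangent space at `base t`, such that the total map
`|Δⁿ| × ℝⁿ → T*M` is smooth (up to the boundary). -/
structure BundleHom (n : ℕ) where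
  base : simplex n → M
  fib : ∀ t : simplex n, (Fin n → ℝ) →L[ℝ] Cotangent (d := d) (base t)
  smooth' : ContMDiffOn 𝓘(ℝ, (Fin n → ℝ) × (Fin n → ℝ))
    ((𝓡 d).prod 𝓘(ℝ, EuclideanSpace ℝ (Fin d) →L[ℝ] ℝ)) ∞
    (fun q => Bundle.TotalSpace.mk' (EuclideanSpace ℝ (Fin d) →L[ℝ] ℝ)
      (E := fun p : M => Cotangent (d := d) p) (base (toSimplex n q.1)) (fib (toSimplex n q.1) q.2))
    (simplex n ×ˢ Set.univ)

namespace BundleHom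

/-- The total map of a vector bundle morphism. -/
def total {n : ℕ} (X : BundleHom d M n) (t : simplex n) (v : Fin n → ℝ) :
    Bundle.TotalSpace (EuclideanSpace ℝ (Fin d) →L[ℝ] ℝ) (fun p : M => Cotangent (d := d) p) :=
  ⟨X.base t, X.fib t v⟩

theorem ext_total {n : ℕ} {X Y : BundleHom d M n} (h : ∀ t v, X.total t v = Y.total t v) :
    X = Y := by
  obtain ⟨b, a, h₁⟩ := X
  obtain ⟨b', a', h₂⟩ := Y
  obtain rfl : b = b' := funext fun t => congrArg (fun z => z.1) (h t 0)
  obtain rfl : a = a' := by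
    funext t
    ext v : 1
    have := h t v
    simpa [total] using this
  rfl

/-- The restriction of a morphism along the affine map `|Δᵐ| → |Δⁿ|` given by a map of
vertices. -/
def comp {m n : ℕ} (X : BundleHom d M n) (θ : Fin (m + 1) → Fin (n + 1)) : BundleHom d M m where
  base t := X.base (simplexSubMap θ t)
  fib t := (X.fib (simplexSubMap θ t)).comp (simplexLin θ)
  smooth' := by
    have hg : ContMDiffOn 𝓘(ℝ, (Fin m → ℝ) × (Fin m → ℝ)) 𝓘(ℝ, (Fin n → ℝ) × (Fin n → ℝ)) ∞
        (fun q : (Fin m → ℝ) × (Fin m → ℝ) => (simplexMap θ q.1, simplexLin θ q.2))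
        (simplex m ×ˢ Set.univ) := by
      apply ContDiffOn.contMDiffOn
      apply ContDiff.contDiffOn
      unfold simplexMap
      fun_prop
    refine (X.smooth'.comp hg fun q hq => ⟨simplexMap_mem θ hq.1, trivial⟩).congr fun q hq => ?_
    have h₁ : toSimplex n (simplexMap θ q.1) = simplexSubMap θ (toSimplex m q.1) := by
      rw [toSimplex_of_mem hq.1, toSimplex_of_mem (simplexMap_mem θ hq.1)]; rfl
    exact congrArg (fun z => Bundle.TotalSpace.mk' (EuclideanSpace ℝ (Fin d) →L[ℝ] ℝ)
      (E := fun p : M => Cotangent (d := d) p) (X.base z) (X.fib z (simplexLin θ q.2))) h₁.symm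

theorem total_comp {m n : ℕ} (X : BundleHom d M n) (θ : Fin (m + 1) → Fin (n + 1)) (t : simplex m)
    (v : Fin m → ℝ) : (X.comp θ).total t v = X.total (simplexSubMap θ t) (simplexLin θ v) := rfl

/-- The pullback `X*W` of a `k`-vector field, a differential `k`-form on `|Δⁿ|`:
`(X*W)_t(v₁, …, v_k) = W(X_t v₁, …, X_t v_k)`. -/
def pullback {n k : ℕ} (X : BundleHom d M n) (W : MultiVector d M k) (t : Fin n → ℝ) :
    (Fin n → ℝ) [⋀^Fin k]→L[ℝ] ℝ :=
  (W (X.base (toSimplex n t))).compContinuousLinearMap (X.fib (toSimplex n t))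

/-- `X : T|Δⁿ| → T*M` is a morphism of Lie algebroids: pulling back along `X` commutes with
`d_Π` and the de Rham differential, on functions and on sections of the dual bundle
`(T*M)* = TM` (these generate the algebra of Lie algebroid forms). In the second condition `f` and
`g` serve to extend the covectors `X_t v` and `X_t w` to sections of `T*M`. -/
structure IsLieAlgebroidMorphism {n : ℕ} (X : BundleHom d M n) (P : PoissonStructure d M) :
    Prop where
  d_function : ∀ f : M → ℝ, ContMDiff (𝓡 d) 𝓘(ℝ, ℝ) ∞ f → ∀ (t : simplex n) (v : Fin n → ℝ),
    fderivWithin ℝ (fun s => f (X.base (toSimplex n s))) (simplex n) t v =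
      P.dFunction f (X.base t) (X.fib t v)
  d_vector : ∀ V : ∀ p : M, TangentSpace (𝓡 d) p,
    ContMDiff (𝓡 d) (𝓡 d).tangent ∞ (fun p => (⟨p, V p⟩ : TangentBundle (𝓡 d) M)) →
    ∀ f g : M → ℝ, ContMDiff (𝓡 d) 𝓘(ℝ, ℝ) ∞ f → ContMDiff (𝓡 d) 𝓘(ℝ, ℝ) ∞ g →
    ∀ (t : simplex n) (v w : Fin n → ℝ),
    X.fib t v = differential f (X.base t) → X.fib t w = differential g (X.base t) →
    extDerivWithin (X.pullback fun p => evalVector (V p)) (simplex n) t ![v, w] =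
      P.dVector V f g (X.base t)

theorem base_smooth {n : ℕ} (X : BundleHom d M n) :
    ContMDiffOn 𝓘(ℝ, Fin n → ℝ) (𝓡 d) ∞ (fun s => X.base (toSimplex n s)) (simplex n) := by
  have h := (Bundle.contMDiff_proj (n := ∞) (IB := 𝓡 d) (F := EuclideanSpace ℝ (Fin d) →L[ℝ] ℝ)
    (fun p : M => Cotangent (d := d) p)).comp_contMDiffOn X.smooth'
  have hg : ContMDiffOn 𝓘(ℝ, Fin n → ℝ) 𝓘(ℝ, (Fin n → ℝ) × (Fin n → ℝ)) ∞
      (fun s : Fin n → ℝ => (s, (0 : Fin n → ℝ))) (simplex n) := by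
    apply ContDiffOn.contMDiffOn
    fun_prop
  exact h.comp hg fun s hs => ⟨hs, trivial⟩

theorem pairing_smooth {n : ℕ} (X : BundleHom d M n) {V : ∀ p : M, TangentSpace (𝓡 d) p}
    (hV : ContMDiff (𝓡 d) (𝓡 d).tangent ∞ (fun p => (⟨p, V p⟩ : TangentBundle (𝓡 d) M)))
    (v : Fin n → ℝ) : ContDiffOn ℝ ∞ (fun s => (X.fib (toSimplex n s) v : TangentSpace (𝓡 d)
      (X.base (toSimplex n s)) →L[ℝ] ℝ) (V (X.base (toSimplex n s)))) (simplex n) := by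
  have hg : ContMDiffOn 𝓘(ℝ, Fin n → ℝ) 𝓘(ℝ, (Fin n → ℝ) × (Fin n → ℝ)) ∞
      (fun s : Fin n → ℝ => (s, v)) (simplex n) := by
    apply ContDiffOn.contMDiffOn
    fun_prop
  have h₁ := X.smooth'.comp hg fun s hs => ⟨hs, trivial⟩
  have h₂ := hV.comp_contMDiffOn X.base_smooth
  have h₃ := ContMDiffOn.clm_bundle_apply (𝕜 := ℝ) (F₁ := EuclideanSpace ℝ (Fin d)) (F₂ := ℝ)
    (E₁ := fun p : M => TangentSpace (𝓡 d) p) (E₂ := Bundle.Trivial M ℝ) (IB := 𝓡 d)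
    (b := fun s => X.base (toSimplex n s)) (ϕ := fun s => X.fib (toSimplex n s) v)
    (v := fun s => V (X.base (toSimplex n s))) (n := ∞) h₁ h₂
  exact fun s hs => (Bundle.contMDiffWithinAt_totalSpace.1 (h₃ s hs)).2.contDiffWithinAt

/-- `X*V` is a differentiable `1`-form, for a smooth vector field `V`. -/
theorem pullback_differentiable {n : ℕ} (X : BundleHom d M n) {V : ∀ p : M, TangentSpace (𝓡 d) p}
    (hV : ContMDiff (𝓡 d) (𝓡 d).tangent ∞ (fun p => (⟨p, V p⟩ : TangentBundle (𝓡 d) M))) :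
    DifferentiableOn ℝ (X.pullback fun p => evalVector (V p)) (simplex n) := by
  have h : (X.pullback fun p => evalVector (V p)) = fun s => ∑ i : Fin n,
      ((X.fib (toSimplex n s) (Pi.single i 1) : TangentSpace (𝓡 d)
        (X.base (toSimplex n s)) →L[ℝ] ℝ) (V (X.base (toSimplex n s)))) •
      (ContinuousAlternatingMap.ofSubsingleton ℝ (Fin n → ℝ) ℝ (0 : Fin 1)
        (ContinuousLinearMap.proj (R := ℝ) (φ := fun _ : Fin n => ℝ) i)) := by
    funext s
    ext v
    have hv : v 0 = ∑ i : Fin n, v 0 i • (Pi.single i 1 : Fin n → ℝ) := by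
      ext k; simp [Pi.single_apply]
    have h₁ : X.pullback (fun p => evalVector (V p)) s v =
        (X.fib (toSimplex n s) (v 0) : TangentSpace (𝓡 d) (X.base (toSimplex n s)) →L[ℝ] ℝ)
          (V (X.base (toSimplex n s))) := rfl
    rw [h₁]
    conv_lhs => rw [hv]
    rw [map_sum]
    simp [mul_comm]
  rw [h]
  apply DifferentiableOn.fun_sum
  intro i _
  exact ((X.pairing_smooth hV _).differentiableOn (by simp)).smul_const _

theorem pullback_comp {m n k : ℕ} (X : BundleHom d M n) (θ : Fin (m + 1) → Fin (n + 1))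
    (W : MultiVector d M k) {t : Fin m → ℝ} (ht : t ∈ simplex m) :
    (X.comp θ).pullback W t =
      (X.pullback W (simplexMap θ t)).compContinuousLinearMap (simplexLin θ) := by
  have h₁ : toSimplex n (simplexMap θ t) = simplexSubMap θ (toSimplex m t) := by
    rw [toSimplex_of_mem ht, toSimplex_of_mem (simplexMap_mem θ ht)]; rfl
  unfold pullback
  rw [h₁]
  rfl

theorem hasFDerivWithinAt_simplexMap {m n : ℕ} (θ : Fin (m + 1) → Fin (n + 1)) (s : Set (Fin m → ℝ))
    (t : Fin m → ℝ) : HasFDerivWithinAt (simplexMap (n := n) θ) (simplexLin θ) s t :=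
  ((simplexLin θ).hasFDerivWithinAt).const_add _

theorem contDiff_simplexMap {m n : ℕ} {r : WithTop ℕ∞} (θ : Fin (m + 1) → Fin (n + 1)) :
    ContDiff ℝ r (simplexMap (m := m) (n := n) θ) := by
  unfold simplexMap; fun_prop

/-- Lie algebroid morphisms restrict to Lie algebroid morphisms. -/
theorem IsLieAlgebroidMorphism.comp {m n : ℕ} {X : BundleHom d M n} {P : PoissonStructure d M}
    (h : X.IsLieAlgebroidMorphism P) (θ : Fin (m + 1) → Fin (n + 1)) :
    (X.comp θ).IsLieAlgebroidMorphism P where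
  d_function f hf t v := by
    have hu := (uniqueDiffOn_simplex m) t t.2
    have hd : DifferentiableWithinAt ℝ (fun s => f (X.base (toSimplex n s))) (simplex n)
        (simplexMap θ t) :=
      ((hf.comp_contMDiffOn X.base_smooth).contDiffOn.differentiableOn (by simp)) _
        (simplexMap_mem θ t.2)
    have h₁ := h.d_function f hf (simplexSubMap θ t) (simplexLin θ v)
    have h₂ := (hd.hasFDerivWithinAt.comp (t : Fin m → ℝ) (hasFDerivWithinAt_simplexMap θ _ _)
      fun s hs => simplexMap_mem θ hs).congr (f₁ := fun s => f ((X.comp θ).base (toSimplex m s)))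
      (fun s hs => by
        simp only [Function.comp_apply, toSimplex_of_mem hs, toSimplex_of_mem (simplexMap_mem θ hs)]
        rfl)
      (by
        simp only [Function.comp_apply, toSimplex_of_mem t.2,
          toSimplex_of_mem (simplexMap_mem θ t.2)]
        rfl)
    rw [h₂.fderivWithin hu]
    exact h₁
  d_vector V hV f g hf hg t v w hv hw := by
    have h₁ := h.d_vector V hV f g hf hg (simplexSubMap θ t) (simplexLin θ v) (simplexLin θ w) hv hw
    have hfd : ∀ s ∈ simplex m, fderivWithin ℝ (simplexMap (n := n) θ) (simplex m) s =
        simplexLin θ := fun s hs =>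
      (hasFDerivWithinAt_simplexMap θ _ _).fderivWithin (uniqueDiffOn_simplex m s hs)
    have h₂ := extDerivWithin_pullback (r := 2) (f := simplexMap θ) (s := simplex m)
      (X.pullback_differentiable hV (simplexMap θ t) (simplexMap_mem θ t.2))
      (contDiff_simplexMap θ).contDiffWithinAt (by simp) (uniqueDiffOn_simplex m)
      (by
        rw [(convex_simplex m).closure_interior_eq_closure_of_nonempty_interior
          (interior_simplex_nonempty m)]
        exact subset_closure t.2) t.2 (fun s hs => simplexMap_mem θ hs)
    rw [hfd t t.2] at h₂
    have h₃ : extDerivWithin ((X.comp θ).pullback fun p => evalVector (V p)) (simplex m) t =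
        extDerivWithin (fun s => (X.pullback (fun p => evalVector (V p))
          (simplexMap θ s)).compContinuousLinearMap
            (fderivWithin ℝ (simplexMap θ) (simplex m) s)) (simplex m) t := by
      apply extDerivWithin_congr'
      · intro s hs
        simp only [hfd s hs]
        exact X.pullback_comp θ _ hs
      · exact t.2
    rw [h₃, h₂]
    have h₄ : (simplexLin (n := n) θ) ∘ ![v, w] = ![simplexLin θ v, simplexLin θ w] := by
      funext i; fin_cases i <;> rfl
    rw [ContinuousAlternatingMap.compContinuousLinearMap_apply, h₄]
    exact h₁

end BundleHom

end Poisson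

/-! ### Cochains and multiplicative line bundles on a simplicial set -/

section Simplicial

variable {K : SSet.{u}}

/-- The simplicial coboundary `δ* f = ∑ᵢ (-1)ⁱ dᵢ* f`. -/
def coboundary {A : Type*} [AddCommGroup A] {n : ℕ} (f : K _⦋n⦌ → A) (x : K _⦋n + 1⦌) : A :=
  ∑ i : Fin (n + 2), (-1 : ℤ) ^ (i : ℕ) • f (K.δ i x)

/-- `f` is an `n`-cocycle with values in the abelian group `A`. -/
def IsCocycle {A : Type*} [AddCommGroup A] {n : ℕ} (f : K _⦋n⦌ → A) : Prop :=
  ∀ x : K _⦋n + 1⦌, coboundary f x = 0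

/-- `f` is an `n`-cocycle with values in the multiplicative abelian group `S¹`. -/
def IsCircleCocycle {n : ℕ} (f : K _⦋n⦌ → Circle) : Prop :=
  IsCocycle (A := Additive Circle) fun x => Additive.ofMul (f x)

/-- Homotopy relative to the boundary for `2`-simplices: `x` and `x'` have the same faces, and
are two faces of a `3`-simplex whose remaining two faces are degenerate. -/
def Homotopic (x x' : K _⦋2⦌) : Prop :=
  (∀ i, K.δ i x = K.δ i x') ∧ ∃ y : K _⦋3⦌, K.δ 0 y = K.σ 1 (K.δ 0 x) ∧
    K.δ 1 y = K.σ 1 (K.δ 1 x) ∧ K.δ 2 y = x ∧ K.δ 3 y = x'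

variable (K) in
/-- A multiplicative (complex) line bundle on a simplicial set: a complex line over every
`1`-simplex ("arrow") and, for every `2`-simplex `x` ("composable pair") with edges `a = d₂ x`,
`b = d₀ x` and `c = d₁ x`, a nonzero bilinear map `L_a × L_b → L_c`, which is associative over
every `3`-simplex. -/
structure MultiplicativeLineBundle where
  fiber : K _⦋1⦌ → Type
  [addCommGroup : ∀ a, AddCommGroup (fiber a)]
  [module : ∀ a, Module ℂ (fiber a)]
  finrank_fiber : ∀ a, Module.finrank ℂ (fiber a) = 1
  mul : ∀ (x : K _⦋2⦌) {a b c : K _⦋1⦌}, K.δ 2 x = a → K.δ 0 x = b → K.δ 1 x = c →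
    (fiber a →ₗ[ℂ] fiber b →ₗ[ℂ] fiber c)
  mul_ne_zero : ∀ (x : K _⦋2⦌) {a b c : K _⦋1⦌} (ha : K.δ 2 x = a) (hb : K.δ 0 x = b)
    (hc : K.δ 1 x = c), mul x ha hb hc ≠ 0
  /-- Here `eᵢⱼ` is the edge of the `3`-simplex `y` from vertex `i` to vertex `j`. -/
  mul_assoc : ∀ (y : K _⦋3⦌) {e₀₁ e₁₂ e₂₃ e₀₂ e₁₃ e₀₃ : K _⦋1⦌}
    (h₀₁ : K.δ 2 (K.δ 3 y) = e₀₁) (h₁₂ : K.δ 0 (K.δ 3 y) = e₁₂) (h₀₂ : K.δ 1 (K.δ 3 y) = e₀₂)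
    (h₀₂' : K.δ 2 (K.δ 1 y) = e₀₂) (h₂₃ : K.δ 0 (K.δ 1 y) = e₂₃) (h₀₃ : K.δ 1 (K.δ 1 y) = e₀₃)
    (h₁₂' : K.δ 2 (K.δ 0 y) = e₁₂) (h₂₃' : K.δ 0 (K.δ 0 y) = e₂₃) (h₁₃ : K.δ 1 (K.δ 0 y) = e₁₃)
    (h₀₁' : K.δ 2 (K.δ 2 y) = e₀₁) (h₁₃' : K.δ 0 (K.δ 2 y) = e₁₃) (h₀₃' : K.δ 1 (K.δ 2 y) = e₀₃)
    (u : fiber e₀₁) (v : fiber e₁₂) (w : fiber e₂₃),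
    mul (K.δ 1 y) h₀₂' h₂₃ h₀₃ (mul (K.δ 3 y) h₀₁ h₁₂ h₀₂ u v) w =
      mul (K.δ 2 y) h₀₁' h₁₃' h₀₃' u (mul (K.δ 0 y) h₁₂' h₂₃' h₁₃ v w)

attribute [instance] MultiplicativeLineBundle.addCommGroup MultiplicativeLineBundle.module

/-- The `2`-dimensional face of an `(n+1)`-simplex with the consecutive vertices `k, k+1, k+2`. -/
def triangle {n : ℕ} (x : K _⦋n + 1⦌) (k : Fin n) : K _⦋2⦌ :=
  K.map (SimplexCategory.mkOfLeComp (n := n + 1) k.castSucc.castSucc k.castSucc.succ k.succ.succ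
    (Fin.castSucc_le_succ _) (Fin.succ_le_succ_iff.2 (Fin.castSucc_le_succ _))).op x

/-- The fibre component of the `i`-th face map of the simplicial set with `n`-simplices
`K_n × ℂⁿ` which is determined by `c : K₂ → S¹`. The number `l k` lives over the edge from vertex
`k` to vertex `k + 1`. Deleting an outer vertex forgets a number; deleting the inner vertex `k + 1`
replaces `l k` and `l (k + 1)` by `l k * l (k + 1) * c`, where `c` is evaluated at the triangle
`k, k + 1, k + 2`. -/
def twistedFace (c : K _⦋2⦌ → Circle) {n : ℕ} (i : Fin (n + 2)) (x : K _⦋n + 1⦌)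
    (l : Fin (n + 1) → ℂ) : Fin n → ℂ := fun k =>
  if (k : ℕ) + 1 < i then l k.castSucc
  else if (k : ℕ) + 1 = i then l k.castSucc * l k.succ * (c (triangle x k) : ℂ)
  else l k.succ

end Simplicial

/-! ### The simplicial set `Π_∞(T*M)` and the action -/

section Main

variable {d : ℕ} {M : Type u} [TopologicalSpace M] [ChartedSpace (EuclideanSpace ℝ (Fin d)) M]
  [IsManifold (𝓡 d) ∞ M]

/-- The simplicial set `Π_∞(T*M)`: its `n`-simplices are the Lie algebroid morphisms
`T|Δⁿ| → T*M` which vanish at the vertices of `|Δⁿ|`. -/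
def PiInfinity (P : PoissonStructure d M) : SSet.{u} where
  obj n := {X : BundleHom d M n.unop.len //
    X.IsLieAlgebroidMorphism P ∧ ∀ j, X.fib ⟨vertex _ j, vertex_mem _ j⟩ = 0}
  map θ := TypeCat.ofHom fun X => ⟨X.1.comp θ.unop.toOrderHom, X.2.1.comp _, fun j => by
    have h : ∀ s, s = (⟨vertex _ (θ.unop.toOrderHom j), vertex_mem _ _⟩ : simplex _) →
        X.1.fib s = 0 := by
      rintro s rfl; exact X.2.2 _
    have h' := h (simplexSubMap θ.unop.toOrderHom ⟨vertex _ j, vertex_mem _ j⟩)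
      (Subtype.ext (simplexMap_vertex _ j))
    change (X.1.fib (simplexSubMap θ.unop.toOrderHom ⟨vertex _ j, vertex_mem _ j⟩)).comp _ = 0
    rw [h', ContinuousLinearMap.zero_comp]⟩
  map_id n := by
    ext X
    apply BundleHom.ext_total
    intro t v
    change X.1.total (simplexSubMap (fun i => i) t) (simplexLin (fun i => i) v) = X.1.total t v
    rw [simplexLin_id, show simplexSubMap (fun i => i) t = t from
      Subtype.ext (simplexMap_id _ _)]
  map_comp {a b c} θ φ := by
    ext X
    apply BundleHom.ext_total
    intro t v
    change X.1.total (simplexSubMap (fun i => θ.unop.toOrderHom (φ.unop.toOrderHom i)) t)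
        (simplexLin (fun i => θ.unop.toOrderHom (φ.unop.toOrderHom i)) v) =
      X.1.total (simplexSubMap θ.unop.toOrderHom (simplexSubMap φ.unop.toOrderHom t))
        (simplexLin θ.unop.toOrderHom (simplexLin φ.unop.toOrderHom v))
    rw [simplexLin_comp]
    congr 1
    exact Subtype.ext (simplexMap_comp _ _ _)

/-- The action `S[X] = ∫_{|Δ²|} X*Π` of a morphism `X : T|Δ²| → T*M`. -/
def action (P : PoissonStructure d M) (X : BundleHom d M 2) : ℝ :=
  ∫ t in simplex 2, X.pullback P.bivector t ![Pi.single 0 1, Pi.single 1 1]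

/-- The action as a `2`-cochain on `Π_∞(T*M)`. -/
def actionCochain (P : PoissonStructure d M) (X : (PiInfinity P) _⦋2⦌) : ℝ :=
  action P X.1

/-- The `S¹`-valued cochain `X ↦ exp((i/ħ) S[X])` on `Π_∞(T*M)`. -/
def canonicalCochain (P : PoissonStructure d M) (hbar : ℝ) (X : (PiInfinity P) _⦋2⦌) : Circle :=
  Circle.exp (actionCochain P X / hbar)

end Main

end PoissonCocycle

end

noncomputable section

namespace PoissonCocycle

/-! ### Local coordinates and coordinate fields, extended to globally smooth objects. -/

section Frame

variable {d : ℕ} {M : Type*} [TopologicalSpace M] [ChartedSpace (EuclideanSpace ℝ (Fin d)) M]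

/-! The heart is that `X*Π` is closed. Near the image of a point `t`, choose globally smooth
functions `x_j` and vector fields `V_j` which restrict to coordinates and the dual frame
(`exists_dual_frame`), and consider on the simplex the 1-forms `A_j = X*V_j` and `B_j = d(x_j ∘ X)`.
Expanding a covector in the `dx_j`, the morphism condition on functions gives `X*Π = ½ Σ B_j ∧ A_j`,
which also shows smoothness. The `B_j` are exact, so only `dA_j` contributes to the derivative.
Extending `X_t v` by the differential of `F_v = Σ A_j(v)(t) x_j`, with coefficients frozen at `t`,
the morphism condition on vector fields becomes `dA_j(v,w) = -d{F_v,F_w}(V_j)`, and `d(X*Π)` at `t`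
is half the Jacobi sum of three such functions (`closed_pullback_bivector`).

Stokes on the 3-simplex (`stokes_tetrahedron`) then says that the alternating sum of the four face
integrals vanishes, so `S` is a cocycle. It vanishes on degenerate simplices because a 2-form on an
interval is zero; this gives both the invariance under homotopy and the normalization of `c`.
Exponentiation is a homomorphism, so `c` inherits everything.

Over a 3-simplex the cocycle identity is exactly associativity of `(u,v) ↦ u v c`. For the total
space, a simplicial operator `θ` sends edge labels to their twisted products along the edge paths
from `θ k` to `θ (k+1)`. The products for consecutive paths multiply up to a value of `c`
(`twistedProd_mul`), which gives functoriality, and the coface maps yield the prescribed formulas.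
-/

theorem differential_congr {f g : M → ℝ} {p : M} (h : f =ᶠ[nhds p] g) :
    differential (d := d) f p = differential g p := by
  unfold differential mvfderiv
  have h₁ := h.mfderiv_eq (I := 𝓡 d) (I' := 𝓘(ℝ, ℝ))
  ext v
  have h₂ : (mfderiv (𝓡 d) 𝓘(ℝ, ℝ) f p : EuclideanSpace ℝ (Fin d) →L[ℝ] ℝ) v =
    (mfderiv (𝓡 d) 𝓘(ℝ, ℝ) g p : EuclideanSpace ℝ (Fin d) →L[ℝ] ℝ) v := by
      exact congrArg (fun z : EuclideanSpace ℝ (Fin d) →L[ℝ] ℝ => z v) h₁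
  exact h₂

theorem differential_const (c : ℝ) (p : M) : differential (d := d) (fun _ => c) p = 0 :=
  mvfderiv_const c

theorem differential_neg (f : M → ℝ) (p : M) :
    differential (d := d) (fun q => -f q) p = -differential f p :=
  mvfderiv_fun_neg

/-- With constant coefficients this realizes any covector in the span of the `d(f i)` at a point as
the differential of a global function. -/
theorem differential_sum_smul [IsManifold (𝓡 d) ∞ M] {ι : Type*} (s : Finset ι) (c : ι → ℝ)
    {f : ι → M → ℝ} (hf : ∀ i, ContMDiff (𝓡 d) 𝓘(ℝ, ℝ) ∞ (f i)) (p : M) :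
    differential (d := d) (fun q => ∑ i ∈ s, c i * f i q) p = ∑ i ∈ s, c i • differential (f i) p := by
  classical
  have hd : ∀ i, MDifferentiableAt (𝓡 d) 𝓘(ℝ, ℝ) (f i) p := fun i =>
    (hf i).mdifferentiableAt (by simp)
  have hd' : ∀ i, MDifferentiableAt (𝓡 d) 𝓘(ℝ, ℝ) (fun q => c i * f i q) p := fun i =>
    mdifferentiableAt_const.mul (hd i)
  induction s using Finset.induction_on with
  | empty => simpa using differential_const 0 p
  | insert a s ha ih =>
    simp only [Finset.sum_insert ha]
    have hs : MDifferentiableAt (𝓡 d) 𝓘(ℝ, ℝ) (fun q => ∑ i ∈ s, c i * f i q) p :=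
      (ContMDiff.mdifferentiableAt (n := ∞)
        (contMDiff_finsetSum fun i _ => contMDiff_const.mul (hf i)) (by simp))
    rw [← ih]
    refine (mvfderiv_fun_add (hd' a) hs).trans ?_
    congr 1
    refine (mvfderiv_fun_mul mdifferentiableAt_const (hd a)).trans ?_
    rw [mvfderiv_const, smul_zero, add_zero]
    rfl

theorem contMDiff_sum_mul {ι : Type*} (s : Finset ι) (c : ι → ℝ)
    {f : ι → M → ℝ} (hf : ∀ i, ContMDiff (𝓡 d) 𝓘(ℝ, ℝ) ∞ (f i)) :
    ContMDiff (𝓡 d) 𝓘(ℝ, ℝ) ∞ (fun q => ∑ i ∈ s, c i * f i q) :=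
  contMDiff_finsetSum fun i _ => contMDiff_const.mul (hf i)

/-- Near every point of a manifold there are globally defined smooth functions and vector fields
which restrict to coordinates and the corresponding coordinate fields. -/
theorem exists_dual_frame [T2Space M] [IsManifold (𝓡 d) ∞ M] (p₀ : M) :
    ∃ (x : Fin d → M → ℝ) (V : Fin d → ∀ p : M, TangentSpace (𝓡 d) p),
      (∀ i, ContMDiff (𝓡 d) 𝓘(ℝ, ℝ) ∞ (x i)) ∧
      (∀ i, ContMDiff (𝓡 d) (𝓡 d).tangent ∞
        (fun p => (⟨p, V i p⟩ : TangentBundle (𝓡 d) M))) ∧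
      ∀ᶠ p in nhds p₀,
        (∀ i j, (differential (x i) p : TangentSpace (𝓡 d) p →L[ℝ] ℝ) (V j p) =
          if i = j then 1 else 0) ∧
        ∀ α : Cotangent (d := d) p,
          α = ∑ j, (α : TangentSpace (𝓡 d) p →L[ℝ] ℝ) (V j p) • differential (x j) p := by
  let E := EuclideanSpace ℝ (Fin d)
  let φ : SmoothBumpFunction (𝓡 d) p₀ := Classical.choice inferInstance
  let e := trivializationAt E (TangentSpace (𝓡 d) : M → Type _) p₀
  let b := (EuclideanSpace.basisFun (Fin d) ℝ).toBasis
  -- The differential at `p` sees a neighbourhood of `p`, so the cutoff must be `1` near each `p`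
  -- close to `p₀`, not only at `p`.
  have hφ : ∀ᶠ p in nhds p₀, ∀ᶠ q in nhds p, φ q = 1 :=
    φ.eventuallyEq_one.eventually_nhds
  refine ⟨fun i q => φ q • (extChartAt (𝓡 d) p₀ q) i, fun i => ⇑φ • e.localFrame b i,
    fun i => ?_, fun i => ?_, ?_⟩
  · apply φ.contMDiff_smul
    have h₁ : ContMDiffOn (𝓡 d) 𝓘(ℝ, E) ∞ (extChartAt (𝓡 d) p₀) (chartAt E p₀).source :=
      contMDiffOn_extChartAt
    exact ((EuclideanSpace.proj (𝕜 := ℝ) i).contDiff.contMDiff).comp_contMDiffOn h₁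
  · refine ContMDiffOn.smul_section_of_tsupport (u := e.baseSet) φ.contMDiff.contMDiffOn
      e.open_baseSet φ.tsupport_subset_chartAt_source ?_
    exact e.contMDiffOn_localFrame_baseSet ∞ b i
  · filter_upwards [hφ, (chartAt E p₀).open_source.mem_nhds (mem_chart_source E p₀)] with p hp hps
    have hpe : p ∈ e.baseSet := hps
    have hV : ∀ j, (⇑φ • e.localFrame b j : ∀ q : M, TangentSpace (𝓡 d) q) p =
        e.symmL ℝ p (b j) := fun j => by
      have h1 : φ p = 1 := hp.self_of_nhds
      simp only [Pi.smul_apply', h1, one_smul, e.localFrame_apply_of_mem_baseSet b hpe]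
      rw [e.symmL_apply hpe]
      simp [Bundle.Trivialization.basisAt]
    -- The tangent trivialization at `p₀` is the derivative of the chart at `p₀`; hence `dx_i` is
    -- its `i`-th component.
    have hx : ∀ i w, (differential (fun q => φ q • (extChartAt (𝓡 d) p₀ q) i) p :
        TangentSpace (𝓡 d) p →L[ℝ] ℝ) w = (e.continuousLinearMapAt ℝ p w) i := fun i w => by
      have h₀ : (fun q => φ q • (extChartAt (𝓡 d) p₀ q) i) =ᶠ[nhds p]
          (EuclideanSpace.proj (𝕜 := ℝ) i : E →L[ℝ] ℝ) ∘ (extChartAt (𝓡 d) p₀) := by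
        filter_upwards [hp] with q hq
        simp [hq]
      rw [differential_congr h₀]
      have hm : MDifferentiableAt (𝓡 d) 𝓘(ℝ, E) (extChartAt (𝓡 d) p₀) p :=
        mdifferentiableAt_extChartAt hps
      have h₂ := mfderiv_comp p
        (EuclideanSpace.proj (𝕜 := ℝ) i : E →L[ℝ] ℝ).differentiableAt.mdifferentiableAt hm
      rw [mfderiv_eq_fderiv, ContinuousLinearMap.fderiv] at h₂
      rw [TangentBundle.continuousLinearMapAt_trivializationAt hps]
      exact congrArg (fun z : E →L[ℝ] ℝ => z w) h₂
    refine ⟨fun i j => ?_, fun α => ?_⟩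
    · rw [hV, hx, e.continuousLinearMapAt_symmL hpe]
      simp [b]
    · ext w
      have hw : w = ∑ j, (e.continuousLinearMapAt ℝ p w) j • e.symmL ℝ p (b j) := by
        have h₁ : e.continuousLinearMapAt ℝ p w =
            ∑ j, (e.continuousLinearMapAt ℝ p w) j • b j := by
          conv_lhs => rw [← b.sum_repr (e.continuousLinearMapAt ℝ p w)]
          simp [b]
        conv_lhs => rw [← e.symmL_continuousLinearMapAt (R := ℝ) hpe w, h₁, map_sum]
        simp
      conv_lhs => rw [hw]
      rw [map_sum]
      simp only [map_smul, sum_apply, smul_apply]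
      refine Finset.sum_congr rfl fun j _ => ?_
      rw [hV]
      refine (mul_comm _ _).trans ?_
      exact congrArg (fun z : ℝ => _ * z) (hx j w).symm

end Frame

/-! ### Algebra of alternating bilinear forms. -/

section TwoForms

variable {V : Type*} [AddCommGroup V] [Module ℝ V] [TopologicalSpace V]

theorem alternating_swap (η : V [⋀^Fin 2]→L[ℝ] ℝ) (v w : V) : η ![v, w] = -η ![w, v] := by
  have h := η.map_swap ![w, v] (show (0 : Fin 2) ≠ 1 by decide)
  refine Eq.trans (congrArg η ?_) h
  funext i
  fin_cases i <;> rfl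

theorem alternating_sum_right (η : V [⋀^Fin 2]→L[ℝ] ℝ) {ι : Type*} (s : Finset ι) (v : V)
    (c : ι → ℝ) (w : ι → V) : η ![v, ∑ i ∈ s, c i • w i] = ∑ i ∈ s, c i * η ![v, w i] := by
  have h : ∀ u, η ![v, u] = η.toMultilinearMap.toLinearMap ![v, 0] 1 u := fun u => by
    refine congrArg η ?_
    funext i
    fin_cases i <;> rfl
  simp only [h, map_sum, map_smul, smul_eq_mul]

theorem alternating_zero_right (η : V [⋀^Fin 2]→L[ℝ] ℝ) (v : V) : η ![v, 0] = 0 :=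
  η.map_coord_zero 1 rfl

theorem alternating_neg_right (η : V [⋀^Fin 2]→L[ℝ] ℝ) (v w : V) : η ![v, -w] = -η ![v, w] := by
  simpa using alternating_sum_right η (Finset.univ : Finset Unit) v (fun _ => -1) (fun _ => w)

theorem alternating_sub_right (η : V [⋀^Fin 2]→L[ℝ] ℝ) (v u w : V) :
    η ![v, u - w] = η ![v, u] - η ![v, w] := by
  have h := alternating_sum_right η Finset.univ v ![1, -1] ![u, w]
  simpa [Fin.sum_univ_two, ← sub_eq_add_neg] using h

theorem alternating_self (η : V [⋀^Fin 2]→L[ℝ] ℝ) (v : V) : η ![v, v] = 0 :=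
  η.map_eq_zero_of_eq _ (i := 0) (j := 1) rfl (by decide)

end TwoForms

/-! ### Smoothness and closedness of `X*Π`. -/

section Closedness

variable {d : ℕ} {M : Type*} [TopologicalSpace M] [ChartedSpace (EuclideanSpace ℝ (Fin d)) M]

theorem PoissonStructure.bracket_swap (P : PoissonStructure d M) (f g : M → ℝ) :
    P.bracket f g = fun q => -P.bracket g f q :=
  funext fun q => alternating_swap (P.bivector q) _ _

/-- The Poisson bivector field is closed in the Lie algebroid cohomology of `T*M`. -/
theorem PoissonStructure.dBivector_bivector (P : PoissonStructure d M) {f g h : M → ℝ}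
    (hf : ContMDiff (𝓡 d) 𝓘(ℝ, ℝ) ∞ f) (hg : ContMDiff (𝓡 d) 𝓘(ℝ, ℝ) ∞ g)
    (hh : ContMDiff (𝓡 d) 𝓘(ℝ, ℝ) ∞ h) (p : M) : P.dBivector P.bivector f g h p = 0 := by
  have hJ := P.jacobi' f g h hf hg hh p
  change P.bivector p ![differential f p, differential (P.bracket g h) p] +
    P.bivector p ![differential g p, differential (P.bracket h f) p] +
    P.bivector p ![differential h p, differential (P.bracket f g) p] = 0 at hJ
  change P.bivector p ![differential f p, differential (P.bracket g h) p] -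
    P.bivector p ![differential g p, differential (P.bracket f h) p] +
    P.bivector p ![differential h p, differential (P.bracket f g) p] -
    P.bivector p ![differential (P.bracket f g) p, differential h p] +
    P.bivector p ![differential (P.bracket f h) p, differential g p] -
    P.bivector p ![differential (P.bracket g h) p, differential f p] = 0
  -- By antisymmetry the three derivative terms and the three bracket terms each equal the Jacobi
  -- sum, so the total is twice zero.
  rw [alternating_swap _ (differential (P.bracket f g) p),
    alternating_swap _ (differential (P.bracket f h) p),
    alternating_swap _ (differential (P.bracket g h) p),
    P.bracket_swap f h, differential_neg, alternating_neg_right]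
  linarith

variable [IsManifold (𝓡 d) ∞ M]

namespace BundleHom

theorem pullback_apply₂ {n : ℕ} (X : BundleHom d M n) (W : MultiVector d M 2) (t v w : Fin n → ℝ) :
    X.pullback W t ![v, w] =
      W (X.base (toSimplex n t)) ![X.fib (toSimplex n t) v, X.fib (toSimplex n t) w] := by
  unfold pullback
  rw [ContinuousAlternatingMap.compContinuousLinearMap_apply]
  congr 1
  funext i
  fin_cases i <;> rfl

/-- The pairing of a bundle morphism with a vector field. -/
def pairing {n : ℕ} (X : BundleHom d M n) (V : ∀ p : M, TangentSpace (𝓡 d) p) (t v : Fin n → ℝ) :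
    ℝ :=
  (X.fib (toSimplex n t) v : TangentSpace (𝓡 d) (X.base (toSimplex n t)) →L[ℝ] ℝ)
    (V (X.base (toSimplex n t)))

/-- Along a bundle morphism which is compatible with the differentials on functions, the pullback
of the Poisson bivector field is `∑ dxⱼ ∧ aⱼ / 2`. -/
theorem pullback_bivector_eq_sum {n : ℕ} {X : BundleHom d M n} {P : PoissonStructure d M}
    (hX : X.IsLieAlgebroidMorphism P) {x : Fin d → M → ℝ}
    (hx : ∀ i, ContMDiff (𝓡 d) 𝓘(ℝ, ℝ) ∞ (x i)) {V : Fin d → ∀ p : M, TangentSpace (𝓡 d) p}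
    {s : Fin n → ℝ} (hs : s ∈ simplex n)
    (hV : ∀ α : Cotangent (d := d) (X.base (toSimplex n s)),
      α = ∑ j, (α : TangentSpace (𝓡 d) (X.base (toSimplex n s)) →L[ℝ] ℝ)
        (V j (X.base (toSimplex n s))) • differential (x j) (X.base (toSimplex n s)))
    (v w : Fin n → ℝ) :
    X.pullback P.bivector s ![v, w] = ∑ j, X.pairing (V j) s w *
      fderivWithin ℝ (fun s => x j (X.base (toSimplex n s))) (simplex n) s v := by
  rw [pullback_apply₂]
  conv_lhs => rw [hV (X.fib (toSimplex n s) w)]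
  rw [alternating_sum_right]
  refine Finset.sum_congr rfl fun j _ => ?_
  have h := hX.d_function (x j) (hx j) (toSimplex n s) v
  have h₁ : ((toSimplex n s : simplex n) : Fin n → ℝ) = s := by rw [toSimplex_of_mem hs]
  rw [h₁] at h
  rw [h]
  rfl

end BundleHom

/-- A map into a finite-dimensional space of alternating forms is smooth if its values on all
families of basis vectors are. -/
theorem contDiffOn_alternating {E : Type*} [NormedAddCommGroup E] [NormedSpace ℝ E] {n k : ℕ}
    {r : WithTop ℕ∞} {η : E → (Fin n → ℝ) [⋀^Fin k]→L[ℝ] ℝ} {s : Set E}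
    (h : ∀ v, ContDiffOn ℝ r (fun t => η t v) s) : ContDiffOn ℝ r η s := by
  let A : ((Fin n → ℝ) [⋀^Fin k]→L[ℝ] ℝ) →ₗ[ℝ] ((Fin k → Fin n) → ℝ) :=
    { toFun := fun ζ i => ζ fun l => Pi.single (i l) 1
      map_add' := fun _ _ => rfl
      map_smul' := fun _ _ => rfl }
  -- Forms are determined by their values on basis vectors, so `A` has a linear left inverse, which
  -- is continuous by finite dimensionality.
  have hA : LinearMap.ker A = ⊥ := by
    rw [LinearMap.ker_eq_bot]
    intro ζ ζ' hζ
    apply ContinuousAlternatingMap.toAlternatingMap_injective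
    refine (Pi.basisFun ℝ (Fin n)).ext_alternating fun i _ => ?_
    simpa [A] using congrFun hζ i
  obtain ⟨B, hB⟩ := A.exists_leftInverse_of_injective hA
  have h₁ : η = fun t => LinearMap.toContinuousLinearMap B (A (η t)) := by
    funext t
    exact (LinearMap.congr_fun hB (η t)).symm
  rw [h₁]
  refine (LinearMap.toContinuousLinearMap B).contDiff.comp_contDiffOn ?_
  exact contDiffOn_pi.2 fun i => h _

namespace BundleHom

/-- Locally `X*Π(v,w)` is a sum of products of a pairing of `X` with a frame field and a derivative
of a coordinate along `X`, both smooth in the base point. -/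
theorem smooth_pullback_bivector [T2Space M] {n : ℕ} {X : BundleHom d M n}
    {P : PoissonStructure d M} (hX : X.IsLieAlgebroidMorphism P) :
    ContDiffOn ℝ ∞ (X.pullback P.bivector) (simplex n) := by
  refine contDiffOn_alternating fun v t ht => ?_
  obtain ⟨x, V, hx, hV, hxV⟩ := exists_dual_frame (d := d) (X.base (toSimplex n t))
  have hev := (X.base_smooth t ht).continuousWithinAt.eventually hxV
  have hsm : ∀ j, ContDiffOn ℝ ∞ (fun s => x j (X.base (toSimplex n s))) (simplex n) := fun j =>
    ((hx j).comp_contMDiffOn X.base_smooth).contDiffOn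
  have hv : v = ![v 0, v 1] := by funext i; fin_cases i <;> rfl
  have hc : ContDiffWithinAt ℝ ∞ (fun s => ∑ j, X.pairing (V j) s (v 1) *
      fderivWithin ℝ (fun s => x j (X.base (toSimplex n s))) (simplex n) s (v 0)) (simplex n) t := by
    refine ContDiffWithinAt.sum fun j _ => ContDiffWithinAt.mul ?_ ?_
    · exact X.pairing_smooth (hV j) (v 1) t ht
    · exact (((hsm j).fderivWithin (uniqueDiffOn_simplex n) (m := ∞) (by simp)).clm_apply
        contDiffOn_const) t ht
  refine hc.congr_of_eventuallyEq_of_mem ?_ ht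
  filter_upwards [hev, self_mem_nhdsWithin] with s hs hs'
  rw [hv]
  exact pullback_bivector_eq_sum hX hx hs' hs.2 _ _

/-- The exterior derivative of `X*V` in terms of pairings. -/
theorem extDerivWithin_pullback_vector {n : ℕ} (X : BundleHom d M n)
    {V : ∀ p : M, TangentSpace (𝓡 d) p}
    (hV : ContMDiff (𝓡 d) (𝓡 d).tangent ∞ (fun p => (⟨p, V p⟩ : TangentBundle (𝓡 d) M)))
    {t : Fin n → ℝ} (ht : t ∈ simplex n) (v w : Fin n → ℝ) :
    extDerivWithin (X.pullback fun p => evalVector (V p)) (simplex n) t ![v, w] =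
      fderivWithin ℝ (fun s => X.pairing V s w) (simplex n) t v -
        fderivWithin ℝ (fun s => X.pairing V s v) (simplex n) t w := by
  rw [extDerivWithin_apply (X.pullback_differentiable hV t ht) (uniqueDiffOn_simplex n t ht),
    Fin.sum_univ_two]
  have h : ∀ u : Fin 1 → Fin n → ℝ, (fun s => X.pullback (fun p => evalVector (V p)) s u) =
      fun s => X.pairing V s (u 0) := fun u => rfl
  simp only [h]
  simp [Fin.removeNth, sub_eq_add_neg]

/-- The coordinate formula for the derivative of a 2-form, used for both closedness and Stokes. -/
theorem extDerivWithin_apply_three {n : ℕ} {η : (Fin n → ℝ) → (Fin n → ℝ) [⋀^Fin 2]→L[ℝ] ℝ}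
    {s : Set (Fin n → ℝ)} {t : Fin n → ℝ} (h : DifferentiableWithinAt ℝ η s t)
    (hs : UniqueDiffWithinAt ℝ s t) (v : Fin 3 → Fin n → ℝ) :
    extDerivWithin η s t v =
      fderivWithin ℝ (fun x => η x ![v 1, v 2]) s t (v 0) -
        fderivWithin ℝ (fun x => η x ![v 0, v 2]) s t (v 1) +
          fderivWithin ℝ (fun x => η x ![v 0, v 1]) s t (v 2) := by
  rw [extDerivWithin_apply h hs, Fin.sum_univ_three]
  have h₀ : (0 : Fin 3).removeNth v = ![v 1, v 2] := by funext i; fin_cases i <;> rfl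
  have h₁ : (1 : Fin 3).removeNth v = ![v 0, v 2] := by funext i; fin_cases i <;> rfl
  have h₂ : (2 : Fin 3).removeNth v = ![v 0, v 1] := by funext i; fin_cases i <;> rfl
  rw [h₀, h₁, h₂]
  simp [sub_eq_add_neg]

/-- The pullback of the Poisson bivector field along a Lie algebroid morphism is closed. -/
theorem closed_pullback_bivector [T2Space M] {n : ℕ} {X : BundleHom d M n}
    {P : PoissonStructure d M} (hX : X.IsLieAlgebroidMorphism P) {t : Fin n → ℝ}
    (ht : t ∈ simplex n) : extDerivWithin (X.pullback P.bivector) (simplex n) t = 0 := by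
  obtain ⟨x, V, hx, hV, hxV⟩ := exists_dual_frame (d := d) (X.base (toSimplex n t))
  have hev := (X.base_smooth t ht).continuousWithinAt.eventually hxV
  have hu := uniqueDiffOn_simplex n t ht
  have hsm : ∀ j, ContDiffOn ℝ ∞ (fun s => x j (X.base (toSimplex n s))) (simplex n) := fun j =>
    ((hx j).comp_contMDiffOn X.base_smooth).contDiffOn
  -- `A j` is the 1-form `X*V_j` and `B j` is `d(x_j ∘ X)`, each evaluated on a fixed vector and
  -- viewed as a function on the simplex.
  set A : Fin d → (Fin n → ℝ) → (Fin n → ℝ) → ℝ := fun j v s => X.pairing (V j) s v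
  set B : Fin d → (Fin n → ℝ) → (Fin n → ℝ) → ℝ := fun j v s =>
    fderivWithin ℝ (fun s => x j (X.base (toSimplex n s))) (simplex n) s v
  have hAd : ∀ j v, DifferentiableWithinAt ℝ (A j v) (simplex n) t := fun j v =>
    (X.pairing_smooth (hV j) v).differentiableOn (by simp) t ht
  have hB₀ : ∀ j, DifferentiableWithinAt ℝ
      (fderivWithin ℝ (fun s => x j (X.base (toSimplex n s))) (simplex n)) (simplex n) t := fun j =>
    ((hsm j).fderivWithin (uniqueDiffOn_simplex n) (m := ∞) (by simp)).differentiableOn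
      (by simp) t ht
  have hBd : ∀ j v, DifferentiableWithinAt ℝ (B j v) (simplex n) t := fun j v =>
    (hB₀ j).clm_apply (differentiableWithinAt_const v)
  have hBsymm : ∀ j v w, fderivWithin ℝ (B j v) (simplex n) t w =
      fderivWithin ℝ (B j w) (simplex n) t v := fun j v w => by
    have h₁ : ∀ v w, fderivWithin ℝ (B j v) (simplex n) t w =
        fderivWithin ℝ (fderivWithin ℝ (fun s => x j (X.base (toSimplex n s))) (simplex n))
          (simplex n) t w v := fun v w => by
      have := (hB₀ j).hasFDerivWithinAt.clm_apply (hasFDerivWithinAt_const v t (simplex n))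
      rw [this.fderivWithin hu]
      simp
    rw [h₁, h₁]
    -- The second derivative within the simplex is symmetric even at boundary points, since these
    -- are limits of interior points.
    refine (hsm j t ht).isSymmSndFDerivWithinAt (by simp; exact ENat.LEInfty.out) (uniqueDiffOn_simplex n) ?_ ht w v
    rw [(convex_simplex n).closure_interior_eq_closure_of_nonempty_interior
      (interior_simplex_nonempty n)]
    exact subset_closure ht
  -- The expression `Σ A_j(w) B_j(v)` is first antisymmetrized in `v, w`; only then do the
  -- derivatives of `A_j` combine to `dA_j` termwise in `j`.
  have hD : ∀ u v w, fderivWithin ℝ (fun s => X.pullback P.bivector s ![v, w]) (simplex n) t u =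
      (1 / 2) * ∑ j, (A j w t * fderivWithin ℝ (B j v) (simplex n) t u +
        B j v t * fderivWithin ℝ (A j w) (simplex n) t u -
        (A j v t * fderivWithin ℝ (B j w) (simplex n) t u +
        B j w t * fderivWithin ℝ (A j v) (simplex n) t u)) := fun u v w => by
    have h₁ : (fun s => X.pullback P.bivector s ![v, w]) =ᶠ[nhdsWithin t (simplex n)] fun s =>
        (1 / 2) * ∑ j, (A j w s * B j v s - A j v s * B j w s) := by
      filter_upwards [hev, self_mem_nhdsWithin] with s hs hs'
      have h₂ := pullback_bivector_eq_sum hX hx hs' hs.2 v w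
      have h₃ := pullback_bivector_eq_sum hX hx hs' hs.2 w v
      rw [alternating_swap] at h₃
      rw [Finset.sum_sub_distrib]
      linarith
    rw [h₁.fderivWithin_eq_of_mem ht]
    have h₂ := (HasFDerivWithinAt.fun_sum (u := Finset.univ) fun j _ =>
      ((hAd j w).hasFDerivWithinAt.mul (hBd j v).hasFDerivWithinAt).sub
        ((hAd j v).hasFDerivWithinAt.mul (hBd j w).hasFDerivWithinAt)).const_mul (1 / 2)
    refine (congrArg (fun z : (Fin n → ℝ) →L[ℝ] ℝ => z u) (h₂.fderivWithin hu)).trans ?_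
    simp
  -- The coefficients are frozen at `t`, so that `dF_v` is `X_t v` at the base point and has
  -- constant components in the frame near it.
  set F : (Fin n → ℝ) → M → ℝ := fun v q => ∑ i, A i v t * x i q
  have hFs : ∀ v, ContMDiff (𝓡 d) 𝓘(ℝ, ℝ) ∞ (F v) := fun v => contMDiff_sum_mul _ _ hx
  have hFd : ∀ v q, differential (F v) q = ∑ i, A i v t • differential (d := d) (x i) q :=
    fun v q => differential_sum_smul _ _ hx q
  have hp := hxV.self_of_nhds
  have hXF : ∀ v, X.fib (toSimplex n t) v = differential (F v) (X.base (toSimplex n t)) :=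
    fun v => by
      rw [hFd]
      exact hp.2 _
  have ht' : toSimplex n t = ⟨t, ht⟩ := toSimplex_of_mem ht
  -- In `dVector` the two terms which differentiate `dF(V_j)` drop out, since that function is
  -- constant near the base point; only the bracket term remains.
  have hdA : ∀ j v w, fderivWithin ℝ (A j w) (simplex n) t v -
      fderivWithin ℝ (A j v) (simplex n) t w =
      -(differential (P.bracket (F v) (F w)) (X.base (toSimplex n t)) :
        TangentSpace (𝓡 d) (X.base (toSimplex n t)) →L[ℝ] ℝ) (V j (X.base (toSimplex n t))) :=
    fun j v w => by
      rw [← X.extDerivWithin_pullback_vector (hV j) ht]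
      have h₁ := hX.d_vector (V j) (hV j) (F v) (F w) (hFs v) (hFs w) (toSimplex n t) v w
        (hXF v) (hXF w)
      have h₂ : ((toSimplex n t : simplex n) : Fin n → ℝ) = t := by rw [ht']
      have h₃ : ∀ f u, P.bracket f (fun q =>
          (differential (F u) q : TangentSpace (𝓡 d) q →L[ℝ] ℝ) (V j q))
          (X.base (toSimplex n t)) = 0 := fun f u => by
        have h₄ : (fun q => (differential (F u) q : TangentSpace (𝓡 d) q →L[ℝ] ℝ) (V j q))
            =ᶠ[nhds (X.base (toSimplex n t))] fun _ => A j u t := by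
          filter_upwards [hxV] with q hq
          rw [hFd]
          have h₅ : (∑ i, A i u t • differential (d := d) (x i) q :
              TangentSpace (𝓡 d) q →L[ℝ] ℝ) (V j q) = ∑ i, A i u t *
                (differential (d := d) (x i) q : TangentSpace (𝓡 d) q →L[ℝ] ℝ) (V j q) := by
            rw [sum_apply]
            rfl
          refine h₅.trans ?_
          simp [hq.1]
        unfold PoissonStructure.bracket
        rw [differential_congr h₄, differential_const, alternating_zero_right]
      rw [h₂] at h₁
      rw [h₁]
      unfold PoissonStructure.dVector
      have h₅ := h₃ (F v) w
      have h₆ := h₃ (F w) v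
      refine (congrArg₂ (fun y z : ℝ => y - z - _) h₅ h₆).trans ?_
      simp
  -- Contracting the frame expansion of `df` with `B_j(u) = Π(X_t u, dx_j)` reassembles `{F_u, f}`.
  -- It turns each Jacobi term into a sum over `j`.
  have hBE : ∀ u (f : M → ℝ), ∑ j, B j u t * (differential f (X.base (toSimplex n t)) :
        TangentSpace (𝓡 d) (X.base (toSimplex n t)) →L[ℝ] ℝ) (V j (X.base (toSimplex n t))) =
      P.bivector (X.base (toSimplex n t)) ![differential (F u) (X.base (toSimplex n t)),
        differential f (X.base (toSimplex n t))] := fun u f => by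
    conv_rhs => rw [hp.2 (differential f (X.base (toSimplex n t)))]
    rw [alternating_sum_right]
    refine Finset.sum_congr rfl fun j _ => ?_
    rw [mul_comm]
    congr 1
    have h₁ := hX.d_function (x j) (hx j) (toSimplex n t) u
    have h₂ : ((toSimplex n t : simplex n) : Fin n → ℝ) = t := by rw [ht']
    rw [h₂] at h₁
    rw [← hXF]
    exact h₁
  ext v
  rw [extDerivWithin_apply_three ((smooth_pullback_bivector hX).differentiableOn (by simp) t ht) hu,
    hD, hD, hD]
  have hJ := P.jacobi' _ _ _ (hFs (v 0)) (hFs (v 1)) (hFs (v 2)) (X.base (toSimplex n t))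
  change P.bivector _ ![differential (F (v 0)) _, differential (P.bracket (F (v 1)) (F (v 2))) _] +
    P.bivector _ ![differential (F (v 1)) _, differential (P.bracket (F (v 2)) (F (v 0))) _] +
    P.bivector _ ![differential (F (v 2)) _, differential (P.bracket (F (v 0)) (F (v 1))) _] = 0
      at hJ
  rw [← hBE, ← hBE, ← hBE, ← Finset.sum_add_distrib, ← Finset.sum_add_distrib] at hJ
  rw [← mul_sub, ← mul_add, ← Finset.sum_sub_distrib, ← Finset.sum_add_distrib]
  refine mul_eq_zero_of_right _ (Eq.trans (Finset.sum_congr rfl fun j _ => ?_) hJ)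
  have e₁ := hdA j (v 0) (v 1)
  have e₂ := hdA j (v 1) (v 2)
  have e₃ := hdA j (v 2) (v 0)
  have s₁ := hBsymm j (v 0) (v 1)
  have s₂ := hBsymm j (v 1) (v 2)
  have s₃ := hBsymm j (v 2) (v 0)
  -- The relations `e` replace each `dA_j` by a bracket derivative, and the relations `s` cancel the
  -- second derivatives of `x_j ∘ X`.
  linear_combination -B j (v 0) t * e₂ - B j (v 1) t * e₃ - B j (v 2) t * e₁ -
    A j (v 2) t * s₁ - A j (v 0) t * s₂ - A j (v 1) t * s₃

end BundleHom

end Closedness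

/-! ### Integration over simplices and Stokes' theorem on the tetrahedron. -/

section Stokes

open MeasureTheory

theorem isClosed_simplex (n : ℕ) : IsClosed (simplex n) := by
  have h : simplex n = (⋂ i : Fin n, {t | 0 ≤ t i}) ∩ {t | ∑ i, t i ≤ 1} := by
    ext t; simp [simplex]
  rw [h]
  exact (isClosed_iInter fun i => isClosed_le continuous_const (continuous_apply i)).inter
    (isClosed_le (by fun_prop) continuous_const)

theorem isCompact_simplex (n : ℕ) : IsCompact (simplex n) := by
  refine (isCompact_univ_pi fun _ : Fin n => isCompact_Icc (a := (0 : ℝ)) (b := 1)).of_isClosed_subset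
    (isClosed_simplex n) fun t ht i _ => ⟨ht.1 i, ?_⟩
  exact (Finset.single_le_sum (fun j _ => ht.1 j) (Finset.mem_univ i)).trans ht.2

theorem integrableOn_simplex {n : ℕ} {f : (Fin n → ℝ) → ℝ} (hf : ContinuousOn f (simplex n)) :
    IntegrableOn f (simplex n) :=
  hf.integrableOn_compact (isCompact_simplex n)

theorem insertNth_mem_simplex {n : ℕ} (i : Fin (n + 1)) (x : ℝ) (s : Fin n → ℝ) :
    (i.insertNth x s : Fin (n + 1) → ℝ) ∈ simplex (n + 1) ↔
      s ∈ simplex n ∧ x ∈ Set.Icc 0 (1 - ∑ j, s j) := by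
  simp only [simplex, Set.mem_ofPred_eq, Fin.forall_iff_succAbove i, Fin.insertNth_apply_same,
    Fin.insertNth_apply_succAbove, Fin.sum_univ_succAbove _ i, Set.mem_Icc]
  constructor
  · rintro ⟨⟨h₁, h₂⟩, h₃⟩
    exact ⟨⟨h₂, by linarith⟩, h₁, by linarith⟩
  · rintro ⟨⟨h₁, h₂⟩, h₃, h₄⟩
    exact ⟨⟨h₃, h₁⟩, by linarith⟩

/-- Integration over `|Δⁿ⁺¹|` along the lines parallel to the `i`-th coordinate axis. -/
theorem integral_simplex_succ {n : ℕ} (i : Fin (n + 1)) {f : (Fin (n + 1) → ℝ) → ℝ}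
    (hf : ContinuousOn f (simplex (n + 1))) :
    ∫ t in simplex (n + 1), f t =
      ∫ s in simplex n, ∫ x in Set.Icc 0 (1 - ∑ j, s j), f (i.insertNth x s) := by
  -- Fubini for the indicator extension: the fibre over `s` is an interval if `s ∈ simplex n` and
  -- empty otherwise.
  have he := (volume_preserving_piFinSuccAbove (fun _ : Fin (n + 1) => ℝ) i).symm
  have hm := (isClosed_simplex (n + 1)).measurableSet
  rw [← integral_indicator hm, ← he.integral_comp' ((simplex (n + 1)).indicator f),
    Measure.volume_eq_prod, integral_prod_symm, ← integral_indicator (isClosed_simplex n).measurableSet]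
  · congr 1
    funext s
    by_cases hs : s ∈ simplex n
    · rw [Set.indicator_of_mem hs, ← integral_indicator measurableSet_Icc]
      congr 1
      funext x
      change (simplex (n + 1)).indicator f (i.insertNth x s) = _
      by_cases hx : x ∈ Set.Icc 0 (1 - ∑ j, s j)
      · rw [Set.indicator_of_mem hx, Set.indicator_of_mem ((insertNth_mem_simplex i x s).2 ⟨hs, hx⟩)]
      · rw [Set.indicator_of_notMem hx, Set.indicator_of_notMem fun h =>
          hx ((insertNth_mem_simplex i x s).1 h).2]
    · rw [Set.indicator_of_notMem hs]
      refine integral_eq_zero_of_ae (Filter.Eventually.of_forall fun x => ?_)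
      change (simplex (n + 1)).indicator f (i.insertNth x s) = 0
      exact Set.indicator_of_notMem (fun h => hs ((insertNth_mem_simplex i x s).1 h).1) _
  · have h := (integrableOn_simplex hf).integrable_indicator hm
    exact (he.integrable_comp_emb (MeasurableEquiv.measurableEmbedding _)).2 h

theorem continuous_insertNth {n : ℕ} (i : Fin (n + 1)) :
    Continuous fun p : ℝ × (Fin n → ℝ) => (i.insertNth p.1 p.2 : Fin (n + 1) → ℝ) :=
  Continuous.finInsertNth i continuous_fst continuous_snd

theorem hasDerivAt_insertNth {n : ℕ} (i : Fin (n + 1)) (s : Fin n → ℝ) (x : ℝ) :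
    HasDerivAt (fun x => (i.insertNth x s : Fin (n + 1) → ℝ)) (Pi.single i 1) x := by
  rw [hasDerivAt_pi]
  intro k
  induction k using Fin.succAboveCases i with
  | x => simpa using hasDerivAt_id' x
  | p k => simpa using hasDerivAt_const x (s k)

/-- The integral of a partial derivative over a simplex. -/
theorem integral_simplex_fderivWithin {n : ℕ} (i : Fin (n + 1)) {F : (Fin (n + 1) → ℝ) → ℝ}
    (hF : ContDiffOn ℝ 1 F (simplex (n + 1))) :
    ∫ t in simplex (n + 1), fderivWithin ℝ F (simplex (n + 1)) t (Pi.single i 1) =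
      (∫ s in simplex n, F (i.insertNth (1 - ∑ j, s j) s)) -
        ∫ s in simplex n, F (i.insertNth 0 s) := by
  have hc : ContinuousOn (fun t => fderivWithin ℝ F (simplex (n + 1)) t (Pi.single i 1))
      (simplex (n + 1)) :=
    (hF.continuousOn_fderivWithin (uniqueDiffOn_simplex _) le_rfl).clm_apply continuousOn_const
  have hi : ∀ {g : (Fin n → ℝ) → ℝ}, Continuous g →
      (∀ s ∈ simplex n, g s ∈ Set.Icc 0 (1 - ∑ j, s j)) →
      IntegrableOn (fun s => F (i.insertNth (g s) s)) (simplex n) := fun {g} hg hg' =>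
    integrableOn_simplex (hF.continuousOn.comp
      ((continuous_insertNth i).comp (hg.prodMk continuous_id)).continuousOn
      fun s hs => (insertNth_mem_simplex i _ s).2 ⟨hs, hg' s hs⟩)
  rw [integral_simplex_succ i hc, ← integral_sub]
  · refine setIntegral_congr_fun (isClosed_simplex n).measurableSet fun s hs => ?_
    have hs0 : (0 : ℝ) ≤ 1 - ∑ j, s j := by linarith [hs.2]
    have hcs : Continuous fun x : ℝ => (i.insertNth x s : Fin (n + 1) → ℝ) :=
      (continuous_insertNth i).comp (continuous_id.prodMk continuous_const)
    have hmap : Set.MapsTo (fun x : ℝ => (i.insertNth x s : Fin (n + 1) → ℝ))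
        (Set.Icc 0 (1 - ∑ j, s j)) (simplex (n + 1)) := fun x hx =>
      (insertNth_mem_simplex i x s).2 ⟨hs, hx⟩
    rw [integral_Icc_eq_integral_Ioc, ← intervalIntegral.integral_of_le hs0]
    refine intervalIntegral.integral_eq_sub_of_hasDerivAt_of_le
      (f := fun x => F (i.insertNth x s)) hs0
      (hF.continuousOn.comp hcs.continuousOn hmap) (fun x hx => ?_)
      (ContinuousOn.intervalIntegrable ?_)
    · have h₁ := (hF.differentiableOn one_ne_zero _ (hmap ⟨hx.1.le, hx.2.le⟩)).hasFDerivWithinAt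
      exact (h₁.comp_hasDerivWithinAt x (hasDerivAt_insertNth i s x).hasDerivWithinAt
        hmap).hasDerivAt (Icc_mem_nhds hx.1 hx.2)
    · rw [Set.uIcc_of_le hs0]
      exact hc.comp hcs.continuousOn hmap
  · exact hi (by fun_prop) fun s hs => ⟨by linarith [hs.2], le_rfl⟩
  · exact hi continuous_const fun s hs => ⟨le_rfl, by linarith [hs.2]⟩

/-- Integrals over a simplex are invariant under involutive relabelings of the vertices. -/
theorem integral_simplex_relabel {n : ℕ} {θ : Fin (n + 1) → Fin (n + 1)}
    (hθ : Function.Involutive θ) (g : (Fin n → ℝ) → ℝ) :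
    ∫ t in simplex n, g (simplexMap θ t) = ∫ t in simplex n, g t := by
  have hinv : Function.Involutive (simplexMap (m := n) θ) := fun t => by
    rw [← simplexMap_comp, funext hθ, simplexMap_id]
  have himg : simplexMap θ '' simplex n = simplex n := by
    refine Set.Subset.antisymm (Set.image_subset_iff.2 fun t ht => simplexMap_mem θ ht)
      fun t ht => ⟨simplexMap θ t, simplexMap_mem θ ht, hinv t⟩
  -- The linear part squares to the identity, so its determinant is `±1`. The sign is immaterial
  -- because functions, not forms, are integrated.
  have hdet : |(simplexLin (n := n) θ).det| = 1 := by
    have h : (simplexLin (n := n) θ : (Fin n → ℝ) →ₗ[ℝ] (Fin n → ℝ)) ∘ₗ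
        (simplexLin (n := n) θ : (Fin n → ℝ) →ₗ[ℝ] (Fin n → ℝ)) = 1 := by
      ext v : 2
      change simplexLin θ (simplexLin θ _) = _
      rw [← simplexLin_comp, funext hθ, simplexLin_id]
      rfl
    have h₁ := congrArg LinearMap.det h
    rw [LinearMap.det_comp, map_one] at h₁
    rcases mul_self_eq_one_iff.1 h₁ with h₂ | h₂
    · exact (congrArg abs h₂).trans abs_one
    · exact (congrArg abs h₂).trans (by simp)
  have h := integral_image_eq_integral_abs_det_fderiv_smul volume
    (isClosed_simplex n).measurableSet
    (fun t _ => BundleHom.hasFDerivWithinAt_simplexMap θ (simplex n) t) hinv.injective.injOn g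
  rw [himg, hdet] at h
  simpa using h.symm

/-- The integral of a `2`-form on `|Δⁿ|` over the triangle with vertices `θ 0, θ 1, θ 2`. -/
def triangleIntegral {n : ℕ} (η : (Fin n → ℝ) → (Fin n → ℝ) [⋀^Fin 2]→L[ℝ] ℝ)
    (θ : Fin 3 → Fin (n + 1)) : ℝ :=
  ∫ t in simplex 2, η (simplexMap θ t)
    ![simplexLin θ (Pi.single 0 1), simplexLin θ (Pi.single 1 1)]

/-- Stokes' theorem for closed `2`-forms on the `3`-simplex. -/
theorem stokes_tetrahedron {η : (Fin 3 → ℝ) → (Fin 3 → ℝ) [⋀^Fin 2]→L[ℝ] ℝ}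
    (hη : ContDiffOn ℝ 1 η (simplex 3)) (hd : ∀ t ∈ simplex 3, extDerivWithin η (simplex 3) t = 0) :
    triangleIntegral η ![1, 2, 3] - triangleIntegral η ![0, 2, 3] + triangleIntegral η ![0, 1, 3] -
      triangleIntegral η ![0, 1, 2] = 0 := by
  set e : Fin 3 → Fin 3 → ℝ := fun i => Pi.single i 1 with he
  have hs : ∀ v : Fin 2 → Fin 3 → ℝ, ContDiffOn ℝ 1 (fun t => η t v) (simplex 3) := fun v =>
    (ContinuousAlternatingMap.apply ℝ (Fin 3 → ℝ) ℝ v).contDiff.comp_contDiffOn hη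
  have hI : ∀ (v : Fin 2 → Fin 3 → ℝ) (i : Fin 3), IntegrableOn
      (fun t => fderivWithin ℝ (fun t => η t v) (simplex 3) t (e i)) (simplex 3) := fun v i =>
    integrableOn_simplex (((hs v).continuousOn_fderivWithin (uniqueDiffOn_simplex _) le_rfl).clm_apply
      continuousOn_const)
  have hJ : ∀ (v : Fin 2 → Fin 3 → ℝ) (θ : Fin 3 → Fin 4), IntegrableOn
      (fun t => η (simplexMap θ t) v) (simplex 2) := fun v θ =>
    integrableOn_simplex ((hs v).continuousOn.comp
      (BundleHom.contDiff_simplexMap (r := 0) θ).continuous.continuousOn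
      fun t ht => simplexMap_mem θ ht)
  have hdiv : (∫ t in simplex 3, fderivWithin ℝ (fun t => η t ![e 1, e 2]) (simplex 3) t (e 0)) -
      (∫ t in simplex 3, fderivWithin ℝ (fun t => η t ![e 0, e 2]) (simplex 3) t (e 1)) +
      (∫ t in simplex 3, fderivWithin ℝ (fun t => η t ![e 0, e 1]) (simplex 3) t (e 2)) = 0 := by
    have h₁ : IntegrableOn (fun t =>
        fderivWithin ℝ (fun t => η t ![e 1, e 2]) (simplex 3) t (e 0) -
          fderivWithin ℝ (fun t => η t ![e 0, e 2]) (simplex 3) t (e 1)) (simplex 3) :=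
      (hI _ _).sub (hI _ _)
    rw [← integral_sub (hI _ _) (hI _ _), ← integral_add h₁ (hI _ _)]
    refine setIntegral_eq_zero_of_forall_eq_zero fun t ht => ?_
    have h := BundleHom.extDerivWithin_apply_three (hη.differentiableOn one_ne_zero t ht)
      (uniqueDiffOn_simplex 3 t ht) e
    rw [hd t ht] at h
    exact h.symm
  rw [integral_simplex_fderivWithin 0 (hs _), integral_simplex_fderivWithin 1 (hs _),
    integral_simplex_fderivWithin 2 (hs _)] at hdiv
  -- The three slanted terms all parametrize the face opposite vertex `0`, with its vertices in
  -- different orders; the flat terms parametrize the other three faces.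
  have hmap : ∀ s : Fin 2 → ℝ,
      (Fin.insertNth (α := fun _ => ℝ) 0 (0 : ℝ) s = simplexMap (n := 3) ![0, 2, 3] s ∧
      Fin.insertNth (α := fun _ => ℝ) 1 (0 : ℝ) s = simplexMap (n := 3) ![0, 1, 3] s ∧
      Fin.insertNth (α := fun _ => ℝ) 2 (0 : ℝ) s = simplexMap (n := 3) ![0, 1, 2] s) ∧
      Fin.insertNth (α := fun _ => ℝ) 0 (1 - ∑ j, s j) s = simplexMap (n := 3) ![1, 2, 3] s ∧
      Fin.insertNth (α := fun _ => ℝ) 1 (1 - ∑ j, s j) s = simplexMap (n := 3) ![2, 1, 3] s ∧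
      Fin.insertNth (α := fun _ => ℝ) 2 (1 - ∑ j, s j) s = simplexMap (n := 3) ![3, 1, 2] s := by
    intro s
    refine ⟨⟨?_, ?_, ?_⟩, ?_, ?_, ?_⟩ <;> funext k <;> fin_cases k <;>
      simp [simplexMap, simplexLin_apply, vertex, Fin.sum_univ_two, Fin.insertNth, Fin.succAboveCases] <;> ring
  have hrel : ∀ (v : Fin 2 → Fin 3 → ℝ) (θ : Fin 3 → Fin 4) (σ : Fin 3 → Fin 3),
      Function.Involutive σ → ∫ t in simplex 2, η (simplexMap (fun i => θ (σ i)) t) v =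
        ∫ t in simplex 2, η (simplexMap θ t) v := fun v θ σ hσ => by
    simp only [simplexMap_comp]
    exact integral_simplex_relabel hσ fun t => η (simplexMap θ t) v
  have hr₁ : ∀ v, ∫ t in simplex 2, η (simplexMap ![2, 1, 3] t) v =
      ∫ t in simplex 2, η (simplexMap ![1, 2, 3] t) v := fun v => by
    rw [← hrel v ![1, 2, 3] ![1, 0, 2] (by intro i; fin_cases i <;> rfl)]
    congr! 3
  -- The order `3, 1, 2` is a cyclic permutation of `1, 2, 3`, not an involution, so it is reached
  -- by two transpositions, the last through `hr₁`.
  have hr₂ : ∀ v, ∫ t in simplex 2, η (simplexMap ![3, 1, 2] t) v =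
      ∫ t in simplex 2, η (simplexMap ![1, 2, 3] t) v := fun v => by
    rw [← hr₁, ← hrel v ![2, 1, 3] ![2, 1, 0] (by intro i; fin_cases i <;> rfl)]
    congr! 3
  simp only [hmap, hr₁, hr₂] at hdiv
  have hlin : ∀ v : Fin 2 → ℝ,
      (simplexLin (n := 3) ![0, 2, 3] v = v 0 • e 1 + v 1 • e 2 ∧
      simplexLin (n := 3) ![0, 1, 3] v = v 0 • e 0 + v 1 • e 2 ∧
      simplexLin (n := 3) ![0, 1, 2] v = v 0 • e 0 + v 1 • e 1) ∧
      simplexLin (n := 3) ![1, 2, 3] v = v 0 • (e 1 - e 0) + v 1 • (e 2 - e 0) := by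
    intro v
    refine ⟨⟨?_, ?_, ?_⟩, ?_⟩ <;> funext k <;> fin_cases k <;>
      simp [simplexLin_apply, vertex, Fin.sum_univ_two, he]
  -- The slanted face has edge vectors `e₁ - e₀` and `e₂ - e₀`; expanding the form on them produces
  -- the three slanted boundary terms with their signs.
  have hslant : triangleIntegral η ![1, 2, 3] =
      (∫ t in simplex 2, η (simplexMap ![1, 2, 3] t) ![e 1, e 2]) -
      (∫ t in simplex 2, η (simplexMap ![1, 2, 3] t) ![e 0, e 2]) +
      ∫ t in simplex 2, η (simplexMap ![1, 2, 3] t) ![e 0, e 1] := by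
    have h₁ : IntegrableOn (fun t => η (simplexMap ![1, 2, 3] t) ![e 1, e 2] -
        η (simplexMap ![1, 2, 3] t) ![e 0, e 2]) (simplex 2) := (hJ _ _).sub (hJ _ _)
    rw [← integral_sub (hJ _ _) (hJ _ _), ← integral_add h₁ (hJ _ _)]
    refine setIntegral_congr_fun (isClosed_simplex 2).measurableSet fun t _ => ?_
    simp only [hlin]
    have h₂ : ∀ ζ : (Fin 3 → ℝ) [⋀^Fin 2]→L[ℝ] ℝ, ζ ![e 1 - e 0, e 2 - e 0] =
        ζ ![e 1, e 2] - ζ ![e 0, e 2] + ζ ![e 0, e 1] := fun ζ => by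
      rw [alternating_sub_right, alternating_swap ζ (e 1 - e 0) (e 2),
        alternating_swap ζ (e 1 - e 0) (e 0), alternating_sub_right, alternating_sub_right,
        alternating_self, alternating_swap ζ (e 2) (e 1), alternating_swap ζ (e 2) (e 0)]
      ring
    simpa using h₂ _
  rw [hslant]
  simp only [triangleIntegral, hlin]
  simp only [Pi.single_eq_same, one_smul, ne_eq, zero_ne_one, one_ne_zero, not_false_eq_true,
    Pi.single_eq_of_ne, zero_smul, add_zero, zero_add]
  linarith

end Stokes

/-! ### The simplicial set and the line bundle twisted by a normalized cocycle. -/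

section TotalSpace

open CategoryTheory

variable {K : SSet.{u}} (c : K _⦋2⦌ → Circle)

/-- The value of `c` on the face with vertices `i ≤ j ≤ k` of a simplex (and `1` if the vertices
are not in this order). -/
def faceValue {n : ℕ} (x : K _⦋n⦌) (i j k : Fin (n + 1)) : ℂ :=
  if h : i ≤ j ∧ j ≤ k then c (K.map (SimplexCategory.mkOfLeComp i j k h.1 h.2).op x) else 1

theorem faceValue_of_le {n : ℕ} (x : K _⦋n⦌) {i j k : Fin (n + 1)} (hij : i ≤ j) (hjk : j ≤ k) :
    faceValue c x i j k = c (K.map (SimplexCategory.mkOfLeComp i j k hij hjk).op x) :=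
  dif_pos ⟨hij, hjk⟩

theorem mkOfLeComp_comp {m n : ℕ} (θ : ⦋m⦌ ⟶ ⦋n⦌) {i j k : Fin (m + 1)} (hij : i ≤ j)
    (hjk : j ≤ k) : SimplexCategory.mkOfLeComp i j k hij hjk ≫ θ =
      SimplexCategory.mkOfLeComp (θ.toOrderHom i) (θ.toOrderHom j) (θ.toOrderHom k)
        (θ.toOrderHom.monotone hij) (θ.toOrderHom.monotone hjk) := by
  ext l : 3
  fin_cases l <;> rfl

theorem faceValue_map {m n : ℕ} (θ : ⦋m⦌ ⟶ ⦋n⦌) (x : K _⦋n⦌) {i j k : Fin (m + 1)} (hij : i ≤ j)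
    (hjk : j ≤ k) : faceValue c (K.map θ.op x) i j k =
      faceValue c x (θ.toOrderHom i) (θ.toOrderHom j) (θ.toOrderHom k) := by
  rw [faceValue_of_le c _ hij hjk, faceValue_of_le c _ (θ.toOrderHom.monotone hij)
    (θ.toOrderHom.monotone hjk), ← mkOfLeComp_comp θ hij hjk, op_comp, Functor.map_comp]
  rfl

variable {c}

/-- A triangle with a repeated vertex factors through a degeneracy of an edge, and there `c` is
normalized to `1`. -/
theorem faceValue_left (hσ : ∀ i z, c (K.σ i z) = 1) {n : ℕ} (x : K _⦋n⦌) {i j : Fin (n + 1)}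
    (hij : i ≤ j) : faceValue c x i i j = 1 := by
  rw [faceValue_of_le c x le_rfl hij]
  have h : SimplexCategory.mkOfLeComp i i j le_rfl hij =
      SimplexCategory.σ 0 ≫ SimplexCategory.mkOfLe i j hij := by
    ext l : 3
    fin_cases l <;> rfl
  have h₁ := hσ 0 (K.map (SimplexCategory.mkOfLe i j hij).op x)
  rw [h, op_comp, Functor.map_comp]
  exact congrArg Subtype.val h₁

theorem faceValue_right (hσ : ∀ i z, c (K.σ i z) = 1) {n : ℕ} (x : K _⦋n⦌) {i j : Fin (n + 1)}
    (hij : i ≤ j) : faceValue c x i j j = 1 := by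
  rw [faceValue_of_le c x hij le_rfl]
  have h : SimplexCategory.mkOfLeComp i j j hij le_rfl =
      SimplexCategory.σ 1 ≫ SimplexCategory.mkOfLe i j hij := by
    ext l : 3
    fin_cases l <;> rfl
  have h₁ := hσ 1 (K.map (SimplexCategory.mkOfLe i j hij).op x)
  rw [h, op_comp, Functor.map_comp]
  exact congrArg Subtype.val h₁

/-- The `3`-simplex of `Δⁿ` with vertices `i ≤ j ≤ k ≤ l`. -/
def tetrahedron {n : ℕ} {i j k l : Fin (n + 1)} (hij : i ≤ j) (hjk : j ≤ k) (hkl : k ≤ l) :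
    ⦋3⦌ ⟶ ⦋n⦌ :=
  SimplexCategory.mkHom
    { toFun := ![i, j, k, l]
      monotone' := Fin.monotone_iff_le_succ.2 fun a => by fin_cases a <;> assumption }

/-- The cocycle identity on the 3-simplex spanned by the four vertices, possibly repeated; its faces
are the four triangles. -/
theorem faceValue_cocycle
    (hδ : ∀ y : K _⦋3⦌, c (K.δ 1 y) * c (K.δ 3 y) = c (K.δ 2 y) * c (K.δ 0 y)) {n : ℕ}
    (x : K _⦋n⦌) {i j k l : Fin (n + 1)} (hij : i ≤ j) (hjk : j ≤ k) (hkl : k ≤ l) :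
    faceValue c x i k l * faceValue c x i j k = faceValue c x i j l * faceValue c x j k l := by
  rw [faceValue_of_le c x (hij.trans hjk) hkl, faceValue_of_le c x hij hjk,
    faceValue_of_le c x hij (hjk.trans hkl), faceValue_of_le c x hjk hkl]
  have h := hδ (K.map (tetrahedron hij hjk hkl).op x)
  have hf : ∀ (a : Fin 4) {p q r : Fin (n + 1)} (hpq : p ≤ q) (hqr : q ≤ r),
      SimplexCategory.δ a ≫ tetrahedron hij hjk hkl = SimplexCategory.mkOfLeComp p q r hpq hqr →
      K.δ a (K.map (tetrahedron hij hjk hkl).op x) =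
        K.map (SimplexCategory.mkOfLeComp p q r hpq hqr).op x := fun a p q r hpq hqr h => by
    rw [← h, op_comp, Functor.map_comp]
    rfl
  rw [hf 1 (hij.trans hjk) hkl (by ext b : 3; fin_cases b <;> rfl),
    hf 3 hij hjk (by ext b : 3; fin_cases b <;> rfl),
    hf 2 hij (hjk.trans hkl) (by ext b : 3; fin_cases b <;> rfl),
    hf 0 hjk hkl (by ext b : 3; fin_cases b <;> rfl)] at h
  exact congrArg Subtype.val h

variable (c)

/-- The product of the numbers `l k` over the edges between the vertices `i` and `j`, with respect
to the multiplication twisted by `c`. -/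
def twistedProd {n : ℕ} (x : K _⦋n⦌) (l : Fin n → ℂ) (i j : Fin (n + 1)) : ℂ :=
  ∏ k : Fin n, if i ≤ k.castSucc ∧ k.succ ≤ j then
    l k * faceValue c x i k.castSucc k.succ else 1

theorem twistedProd_self {n : ℕ} (x : K _⦋n⦌) (l : Fin n → ℂ) (i : Fin (n + 1)) :
    twistedProd c x l i i = 1 := by
  refine Finset.prod_eq_one fun k _ => if_neg fun h => ?_
  exact absurd (h.2.trans h.1) (Fin.castSucc_lt_succ).not_ge

theorem twistedProd_succ {n : ℕ} (x : K _⦋n⦌) (l : Fin n → ℂ) {i : Fin (n + 1)} {k : Fin n}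
    (hik : i ≤ k.castSucc) : twistedProd c x l i k.succ =
      twistedProd c x l i k.castSucc * (l k * faceValue c x i k.castSucc k.succ) := by
  -- The new factor is written as a product over all edges with one nontrivial entry, so that both
  -- sides can be compared factor by factor.
  have h : l k * faceValue c x i k.castSucc k.succ =
      ∏ k' : Fin n, if k' = k then l k' * faceValue c x i k'.castSucc k'.succ else 1 := by
    simp
  rw [h, twistedProd, twistedProd, ← Finset.prod_mul_distrib]
  refine Finset.prod_congr rfl fun k' _ => ?_
  rcases lt_trichotomy k' k with h | rfl | h
  · have h₁ : k'.succ ≤ k.castSucc := h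
    have h₂ : k'.succ ≤ k.succ := Fin.succ_le_succ_iff.2 h.le
    simp [h₁, h₂, h.ne]
  · have h₁ : ¬ k'.succ ≤ k'.castSucc := (Fin.castSucc_lt_succ).not_ge
    simp [h₁, hik]
  · have h₁ : ¬ k'.succ ≤ k.succ := not_le.2 (Fin.succ_lt_succ_iff.2 h)
    have h₂ : ¬ k'.succ ≤ k.castSucc := fun h' => h₁ (h'.trans (Fin.castSucc_le_succ k))
    simp [h₁, h₂, h.ne']

variable {c}

theorem twistedProd_edge (hσ : ∀ i z, c (K.σ i z) = 1) {n : ℕ} (x : K _⦋n⦌) (l : Fin n → ℂ)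
    (k : Fin n) : twistedProd c x l k.castSucc k.succ = l k := by
  rw [twistedProd_succ c x l le_rfl, twistedProd_self, faceValue_left hσ x (Fin.castSucc_le_succ k)]
  simp

/-- `twistedProd` brackets the labels to the left. Rebracketing at an intermediate vertex `j` costs
only `c` on the triangle `i, j, k`: in the induction on `k`, each further edge is absorbed by the
cocycle identity for `i, j, k, k + 1`. -/
theorem twistedProd_mul (hσ : ∀ i z, c (K.σ i z) = 1)
    (hδ : ∀ y : K _⦋3⦌, c (K.δ 1 y) * c (K.δ 3 y) = c (K.δ 2 y) * c (K.δ 0 y)) {n : ℕ}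
    (x : K _⦋n⦌) (l : Fin n → ℂ) {i j k : Fin (n + 1)} (hij : i ≤ j) (hjk : j ≤ k) :
    twistedProd c x l i j * twistedProd c x l j k * faceValue c x i j k =
      twistedProd c x l i k := by
  induction k using Fin.induction with
  | zero =>
    obtain rfl : j = 0 := Fin.le_zero_iff.1 hjk
    rw [twistedProd_self, faceValue_right hσ x hij, mul_one, mul_one]
  | succ k ih =>
    rcases hjk.eq_or_lt with rfl | h
    · rw [twistedProd_self, faceValue_right hσ x hij, mul_one, mul_one]
    · have hjk' : j ≤ k.castSucc := Fin.le_castSucc_iff.2 h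
      rw [twistedProd_succ c x l hjk', twistedProd_succ c x l (hij.trans hjk'), ← ih hjk']
      have hc := faceValue_cocycle hδ x hij hjk' (Fin.castSucc_le_succ k)
      linear_combination -(twistedProd c x l i j * twistedProd c x l j k.castSucc * l k) * hc

variable (c) in
/-- The fibre component of the simplicial operator given by `θ`. -/
def twistedPullback {m n : ℕ} (θ : ⦋m⦌ ⟶ ⦋n⦌) (x : K _⦋n⦌) (l : Fin n → ℂ) : Fin m → ℂ := fun k =>
  twistedProd c x l (θ.toOrderHom k.castSucc) (θ.toOrderHom k.succ)

/-- This is functoriality of the total space: taking twisted products of the labels produced by `θ`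
agrees with one twisted product along the image path. The induction adds one edge at a time, glued
by `twistedProd_mul`. -/
theorem twistedProd_pullback (hσ : ∀ i z, c (K.σ i z) = 1)
    (hδ : ∀ y : K _⦋3⦌, c (K.δ 1 y) * c (K.δ 3 y) = c (K.δ 2 y) * c (K.δ 0 y)) {m n : ℕ}
    (θ : ⦋m⦌ ⟶ ⦋n⦌) (x : K _⦋n⦌) (l : Fin n → ℂ) {i j : Fin (m + 1)} (hij : i ≤ j) :
    twistedProd c (K.map θ.op x) (twistedPullback c θ x l) i j =
      twistedProd c x l (θ.toOrderHom i) (θ.toOrderHom j) := by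
  induction j using Fin.induction with
  | zero =>
    obtain rfl : i = 0 := Fin.le_zero_iff.1 hij
    rw [twistedProd_self, twistedProd_self]
  | succ k ih =>
    rcases hij.eq_or_lt with rfl | h
    · rw [twistedProd_self, twistedProd_self]
    · have hik : i ≤ k.castSucc := Fin.le_castSucc_iff.2 h
      rw [twistedProd_succ c _ _ hik, ih hik, faceValue_map c θ x hik (Fin.castSucc_le_succ k),
        ← twistedProd_mul hσ hδ x l (θ.toOrderHom.monotone hik)
          (θ.toOrderHom.monotone (Fin.castSucc_le_succ k)), ← mul_assoc]
      rfl

/-- The simplicial set with `n`-simplices `Kₙ × ℂⁿ` determined by a normalized multiplicative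
`2`-cocycle `c`. -/
def twistedTotalSpace (hσ : ∀ i z, c (K.σ i z) = 1)
    (hδ : ∀ y : K _⦋3⦌, c (K.δ 1 y) * c (K.δ 3 y) = c (K.δ 2 y) * c (K.δ 0 y)) : SSet.{u} where
  obj n := K.obj n × (Fin n.unop.len → ℂ)
  map θ := TypeCat.ofHom fun z => (K.map θ z.1, twistedPullback c θ.unop z.1 z.2)
  map_id n := by
    refine ConcreteCategory.hom_ext _ _ fun z => ?_
    refine Prod.ext (congrArg (fun f => f z.1) (K.map_id n)) (funext fun k => ?_)
    exact twistedProd_edge hσ z.1 z.2 k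
  map_comp θ φ := by
    refine ConcreteCategory.hom_ext _ _ fun z => ?_
    refine Prod.ext (congrArg (fun f => f z.1) (K.map_comp θ φ)) (funext fun k => ?_)
    exact (twistedProd_pullback hσ hδ θ.unop z.1 z.2
      (φ.unop.toOrderHom.monotone (Fin.castSucc_le_succ k))).symm

/-- The projection of the total space to the base. -/
def twistedProjection (hσ : ∀ i z, c (K.σ i z) = 1)
    (hδ : ∀ y : K _⦋3⦌, c (K.δ 1 y) * c (K.δ 3 y) = c (K.δ 2 y) * c (K.δ 0 y)) :
    twistedTotalSpace hσ hδ ⟶ K where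
  app n := TypeCat.ofHom fun z : K.obj n × (Fin n.unop.len → ℂ) => z.1
  naturality _ _ _ := rfl

/-- Deleting vertex `i` leaves every edge elementary except the one from `i - 1` to `i + 1`, whose
twisted product has two labels and the value of `c` on that triangle. If `i` is an outer vertex, no
such edge occurs. -/
theorem twistedPullback_δ (hσ : ∀ i z, c (K.σ i z) = 1) {n : ℕ} (i : Fin (n + 2)) (x : K _⦋n + 1⦌)
    (l : Fin (n + 1) → ℂ) : twistedPullback c (SimplexCategory.δ i) x l = twistedFace c i x l := by
  funext k
  have h : ∀ j, (SimplexCategory.δ i).toOrderHom j = i.succAbove j := fun _ => rfl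
  unfold twistedPullback twistedFace
  rw [h, h]
  split_ifs with h₁ h₂
  · rw [Fin.succAbove_of_castSucc_lt i k.castSucc (by simp [Fin.lt_def]; omega),
      Fin.succAbove_of_castSucc_lt i k.succ (by simpa [Fin.lt_def] using h₁), ← Fin.succ_castSucc,
      twistedProd_edge hσ]
  · rw [Fin.succAbove_of_castSucc_lt i k.castSucc (by simp [Fin.lt_def]; omega),
      Fin.succAbove_of_le_castSucc i k.succ (by simp [Fin.le_def]; omega),
      twistedProd_succ c x l (k := k.succ) (Fin.castSucc_le_castSucc_iff.2 (Fin.castSucc_le_succ k)),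
      ← Fin.succ_castSucc, twistedProd_edge hσ,
      faceValue_of_le c x (Fin.castSucc_le_succ _)
        (Fin.succ_le_succ_iff.2 (Fin.castSucc_le_succ _)), mul_assoc]
    rfl
  · rw [Fin.succAbove_of_le_castSucc i k.castSucc (by simp [Fin.le_def]; omega),
      Fin.succAbove_of_le_castSucc i k.succ (by simp [Fin.le_def]; omega), Fin.succ_castSucc,
      twistedProd_edge hσ]

/-- The multiplicative line bundle with trivial fibres and multiplication
`(u, v) ↦ u * v * c`. -/
def twistedLineBundle (c : K _⦋2⦌ → Circle)
    (hδ : ∀ y : K _⦋3⦌, c (K.δ 1 y) * c (K.δ 3 y) = c (K.δ 2 y) * c (K.δ 0 y)) :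
    MultiplicativeLineBundle K where
  fiber _ := ℂ
  finrank_fiber _ := Module.finrank_self ℂ
  mul x _ _ _ _ _ _ := (c x : ℂ) • LinearMap.mul ℂ ℂ
  mul_ne_zero x _ _ _ _ _ _ h := by
    have h₁ := LinearMap.congr_fun (LinearMap.congr_fun h (1 : ℂ)) (1 : ℂ)
    simp at h₁
  mul_assoc y _ _ _ _ _ _ _ _ _ _ _ _ _ _ _ _ _ _ u v w := by
    have h : (c (K.δ 1 y) : ℂ) * c (K.δ 3 y) = c (K.δ 2 y) * c (K.δ 0 y) :=
      congrArg Subtype.val (hδ y)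
    simp only [LinearMap.smul_apply, LinearMap.mul_apply', smul_eq_mul]
    linear_combination u * v * w * h

end TotalSpace

/-! ### The action and its exponential as cochains. -/

section Action

variable {d : ℕ} {M : Type u} [TopologicalSpace M] [ChartedSpace (EuclideanSpace ℝ (Fin d)) M]
  [IsManifold (𝓡 d) ∞ M]

/-- Expresses the actions of all faces of a simplex as integrals of one form, as Stokes requires. -/
theorem action_comp (P : PoissonStructure d M) {n : ℕ} (X : BundleHom d M n)
    (θ : Fin 3 → Fin (n + 1)) :
    action P (X.comp θ) = triangleIntegral (X.pullback P.bivector) θ := by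
  refine MeasureTheory.setIntegral_congr_fun (isClosed_simplex 2).measurableSet fun t ht => ?_
  have h : ∀ v w, simplexLin θ ∘ ![v, w] = ![simplexLin θ v, simplexLin θ w] := fun v w => by
    funext i; fin_cases i <;> rfl
  rw [X.pullback_comp θ _ ht, ContinuousAlternatingMap.compContinuousLinearMap_apply, h]

/-- Two vectors in a line are dependent. Degenerate 2-simplices factor through an interval, so their
action vanishes. -/
theorem alternating_eq_zero_of_one (ζ : (Fin 1 → ℝ) [⋀^Fin 2]→L[ℝ] ℝ) (v : Fin 2 → Fin 1 → ℝ) :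
    ζ v = 0 := by
  refine ζ.toAlternatingMap.map_linearDependent v fun h => ?_
  have := h.fintype_card_le_finrank
  simp at this

/-- The action of a degenerate simplex vanishes. -/
theorem actionCochain_σ (P : PoissonStructure d M) (i : Fin 2) (Z : (PiInfinity P) _⦋1⦌) :
    actionCochain P ((PiInfinity P).σ i Z) = 0 := by
  refine (action_comp P (n := 1) Z.1 (SimplexCategory.σ i).toOrderHom).trans ?_
  simp only [triangleIntegral, alternating_eq_zero_of_one, MeasureTheory.integral_zero]

theorem canonicalCochain_σ (P : PoissonStructure d M) (hbar : ℝ) (i : Fin 2)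
    (Z : (PiInfinity P) _⦋1⦌) : canonicalCochain P hbar ((PiInfinity P).σ i Z) = 1 := by
  rw [canonicalCochain, actionCochain_σ, zero_div, Circle.exp_zero]

variable [T2Space M]

/-- The action is a cocycle. -/
theorem actionCochain_δ (P : PoissonStructure d M) (Y : (PiInfinity P) _⦋3⦌) :
    actionCochain P ((PiInfinity P).δ 0 Y) - actionCochain P ((PiInfinity P).δ 1 Y) +
      actionCochain P ((PiInfinity P).δ 2 Y) - actionCochain P ((PiInfinity P).δ 3 Y) = 0 := by
  have h : ∀ (i : Fin 4) (θ : Fin 3 → Fin 4), (∀ j, i.succAbove j = θ j) →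
      actionCochain P ((PiInfinity P).δ i Y) =
        triangleIntegral (Y.1.pullback P.bivector) θ := fun i θ hθ => by
    rw [← funext hθ]
    exact action_comp P (n := 3) Y.1 (SimplexCategory.δ i).toOrderHom
  rw [h 0 ![1, 2, 3] (by decide), h 1 ![0, 2, 3] (by decide), h 2 ![0, 1, 3] (by decide),
    h 3 ![0, 1, 2] (by decide)]
  exact stokes_tetrahedron ((BundleHom.smooth_pullback_bivector Y.2.1).of_le
    ENat.LEInfty.out) fun t ht => BundleHom.closed_pullback_bivector Y.2.1 ht

theorem isCocycle_actionCochain (P : PoissonStructure d M) : IsCocycle (actionCochain P) :=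
  fun Y => by
    have h := actionCochain_δ P Y
    unfold coboundary
    rw [Fin.sum_univ_four]
    simp only [Fin.val_zero, Fin.val_one, Fin.val_two, pow_zero, pow_one, one_smul, neg_smul]
    rw [show ((3 : Fin 4) : ℕ) = 3 from rfl, show (-1 : ℤ) ^ 2 = 1 by norm_num,
      show (-1 : ℤ) ^ 3 = -1 by norm_num]
    simp only [one_smul, neg_smul]
    linarith

/-- The homomorphism `s ↦ exp(i s / ħ)` from `ℝ` to the circle carries the additive coboundary to
the multiplicative one. -/
theorem isCircleCocycle_canonicalCochain (P : PoissonStructure d M) (hbar : ℝ) :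
    IsCircleCocycle (canonicalCochain P hbar) := fun Y => by
  let φ : ℝ →+ Additive Circle := Circle.expHom.comp (AddMonoidHom.mulRight hbar⁻¹)
  have h := congrArg φ (isCocycle_actionCochain P Y)
  unfold coboundary at h
  rw [map_sum, map_zero] at h
  simp only [map_zsmul] at h
  exact h

/-- The cocycle identity with inverses moved across: the left side is the twist of `(uv)w`, the
right side that of `u(vw)`. -/
theorem canonicalCochain_δ (P : PoissonStructure d M) (hbar : ℝ) (Y : (PiInfinity P) _⦋3⦌) :
    canonicalCochain P hbar ((PiInfinity P).δ 1 Y) * canonicalCochain P hbar ((PiInfinity P).δ 3 Y) =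
      canonicalCochain P hbar ((PiInfinity P).δ 2 Y) *
        canonicalCochain P hbar ((PiInfinity P).δ 0 Y) := by
  have h := actionCochain_δ P Y
  unfold canonicalCochain
  rw [← Circle.exp_add, ← Circle.exp_add, ← add_div, ← add_div]
  congr 2
  linarith

/-- Faces `0` and `1` of the connecting 3-simplex are degenerate and contribute zero, so the cocycle
identity reduces to the difference of the other two. -/
theorem actionCochain_eq_of_homotopic (P : PoissonStructure d M) {X X' : (PiInfinity P) _⦋2⦌}
    (h : Homotopic X X') : actionCochain P X = actionCochain P X' := by
  obtain ⟨-, Y, h₀, h₁, h₂, h₃⟩ := h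
  have h := actionCochain_δ P Y
  rw [h₀, h₁, h₂, h₃, actionCochain_σ, actionCochain_σ] at h
  linarith

end Action

end PoissonCocycle

end

theorem mainTheorem6 {d : ℕ} {M : Type u} [TopologicalSpace M] [T2Space M]
    [ChartedSpace (EuclideanSpace ℝ (Fin d)) M] [IsManifold (𝓡 d) ∞ M]
    (P : PoissonCocycle.PoissonStructure d M) (hbar : ℝ) (hhbar : hbar ≠ 0) :
    -- `d_Π Π = 0`
    (∀ f g h : M → ℝ, ContMDiff (𝓡 d) 𝓘(ℝ, ℝ) ∞ f → ContMDiff (𝓡 d) 𝓘(ℝ, ℝ) ∞ g →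
      ContMDiff (𝓡 d) 𝓘(ℝ, ℝ) ∞ h → ∀ p, P.dBivector P.bivector f g h p = 0) ∧
    -- `X*Π` is a smooth closed 2-form on `|Δⁿ|`, for every Lie algebroid morphism `X`
    (∀ (n : ℕ) (X : PoissonCocycle.BundleHom d M n), X.IsLieAlgebroidMorphism P →
      ContDiffOn ℝ ∞ (X.pullback P.bivector) (PoissonCocycle.simplex n) ∧
      ∀ t ∈ PoissonCocycle.simplex n,
        extDerivWithin (X.pullback P.bivector) (PoissonCocycle.simplex n) t = 0) ∧
    -- the integral which defines `S[X]` exists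
    (∀ X : PoissonCocycle.BundleHom d M 2, X.IsLieAlgebroidMorphism P →
      MeasureTheory.IntegrableOn
        (fun t => X.pullback P.bivector t ![Pi.single 0 1, Pi.single 1 1])
        (PoissonCocycle.simplex 2)) ∧
    -- `S` is a 2-cocycle on `Π_∞(T*M)`
    PoissonCocycle.IsCocycle (PoissonCocycle.actionCochain P) ∧
    -- `exp((i/ħ)S)` is an `S¹`-valued 2-cocycle on `Π_∞(T*M)`
    PoissonCocycle.IsCircleCocycle (PoissonCocycle.canonicalCochain P hbar) ∧
    -- both descend to the quotient `Π_∞⁽²⁾/Π_∞⁽³⁾`, the set of composable pairs of `Π₂(T*M)`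
    (∀ X X' : (PoissonCocycle.PiInfinity P) _⦋2⦌, PoissonCocycle.Homotopic X X' →
      PoissonCocycle.actionCochain P X = PoissonCocycle.actionCochain P X' ∧
      PoissonCocycle.canonicalCochain P hbar X = PoissonCocycle.canonicalCochain P hbar X') ∧
    -- the multiplicative line bundle: `(a, u) · (b, v) = (c, exp((i/ħ)S[X]) u v)`
    (∃ (L : PoissonCocycle.MultiplicativeLineBundle (PoissonCocycle.PiInfinity P))
      (τ : ∀ a, L.fiber a ≃ₗ[ℂ] ℂ),
      ∀ (X : (PoissonCocycle.PiInfinity P) _⦋2⦌) {a b c : (PoissonCocycle.PiInfinity P) _⦋1⦌}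
        (ha : (PoissonCocycle.PiInfinity P).δ 2 X = a)
        (hb : (PoissonCocycle.PiInfinity P).δ 0 X = b)
        (hc : (PoissonCocycle.PiInfinity P).δ 1 X = c) (u : L.fiber a) (v : L.fiber b),
        τ c (L.mul X ha hb hc u v) =
          τ a u * τ b v * (PoissonCocycle.canonicalCochain P hbar X : ℂ)) ∧
    -- its total space: a simplicial set over `Π_∞(T*M)` with `n`-simplices `Π_∞⁽ⁿ⁾ × ℂⁿ`
    (∃ (L : SSet.{u}) (pr : L ⟶ PoissonCocycle.PiInfinity P)
      (e : ∀ n : ℕ, L _⦋n⦌ ≃ (PoissonCocycle.PiInfinity P) _⦋n⦌ × (Fin n → ℂ)),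
      (∀ (n : ℕ) (z : L _⦋n⦌), pr.app (Opposite.op ⦋n⦌) z = (e n z).1) ∧
      ∀ (n : ℕ) (i : Fin (n + 2)) (z : L _⦋n + 1⦌),
        e n (L.δ i z) = ((PoissonCocycle.PiInfinity P).δ i (e (n + 1) z).1,
          PoissonCocycle.twistedFace (PoissonCocycle.canonicalCochain P hbar) i
            (e (n + 1) z).1 (e (n + 1) z).2)) := by 
  have hδ := PoissonCocycle.canonicalCochain_δ P hbar
  have hσ := PoissonCocycle.canonicalCochain_σ P hbar
  refine ⟨fun f g h hf hg hh p => P.dBivector_bivector hf hg hh p, fun n X hX =>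
    ⟨PoissonCocycle.BundleHom.smooth_pullback_bivector hX, fun t ht =>
      PoissonCocycle.BundleHom.closed_pullback_bivector hX ht⟩, fun X hX => ?_,
    PoissonCocycle.isCocycle_actionCochain P,
    PoissonCocycle.isCircleCocycle_canonicalCochain P hbar, fun X X' h => ?_,
    ⟨PoissonCocycle.twistedLineBundle _ hδ, fun _ => LinearEquiv.refl ℂ ℂ,
      fun X a b c _ _ _ u v => ?_⟩,
    ⟨PoissonCocycle.twistedTotalSpace hσ hδ, PoissonCocycle.twistedProjection hσ hδ,
      fun n => Equiv.refl _, fun n z => rfl, fun n i z => ?_⟩⟩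
  · exact PoissonCocycle.integrableOn_simplex
      ((ContinuousAlternatingMap.apply ℝ (Fin 2 → ℝ) ℝ _).continuous.comp_continuousOn
        (PoissonCocycle.BundleHom.smooth_pullback_bivector hX).continuousOn)
  · have hS := PoissonCocycle.actionCochain_eq_of_homotopic P h
    exact ⟨hS, by rw [PoissonCocycle.canonicalCochain, hS]; rfl⟩
  -- The bundle multiplication scales by `c` on the left, whereas the stated formula has it on the
  -- right.
  · exact mul_comm _ ((show ℂ from u) * (show ℂ from v))
  · exact Prod.ext rfl (PoissonCocycle.twistedPullback_δ hσ i z.1 z.2)
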